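/- Let $\psi_k,\psi^*_k$ ($k\in\mathbb Z$) be the free fermions, $[\psi_k,\psi_m]_+=[\psi^*_k,\psi^*_m]_+=0$, $[\psi_k,\psi^*_m]_+=\delta_{km}$, acting on the left on the (completed) fermionic Fock space of kets over a commutative $\mathbb Q$-algebra $R$ (for instance $R=\mathbb C$), whose basis states are given by the sets of occupied modes containing almost all negative and almost no non-negative integers ($\psi_k$ fills and $\psi^*_k$ empties the mode $k$, with the sign $(-1)^{\#\{\text{occupied modes}>k\}}$), and acting on the right on the dual space of bras. Let $|0\rangle$ be the Dirac vacuum ($\psi_k|0\rangle=0$ for $k<0$, $\psi^*_k|0\rangle=0$ for $k\ge 0$) and $\langle 0|$ its dual, $\langle 0|0\rangle=1$. For $n\in\mathbb Z$ put $$|n\rangle=\begin{cases}\psi_{n-1}\cdots\psi_1\psi_0|0\rangle,& n\ge 0,\\ \psi^*_n\cdots\psi^*_{-2}\psi^*_{-1}|0\rangle,& n<0,\end{cases}\qquad \langle n|=\begin{cases}\langle 0|\psi^*_0\psi^*_1\cdots\psi^*_{n-1},& n\ge 0,\\ \langle 0|\psi_{-1}\psi_{-2}\cdots\psi_n,& n<0.\end{cases}$$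 For a Young diagram $\lambda$ with $\ell(\lambda)$ non-zero rows, with $d=d(\lambda)$ boxes on the main diagonal and with Frobenius coordinates $\alpha_i=\lambda_i-i$, $\beta_i=\lambda'_i-i$ ($1\le i\le d$), put $$|\lambda,n\rangle=\psi^*_{n-\beta_1-1}\cdots\psi^*_{n-\beta_d-1}\,\psi_{n+\alpha_d}\cdots\psi_{n+\alpha_1}|n\rangle,\qquad \langle\lambda,n|=\langle n|\psi^*_{n+\alpha_1}\cdots\psi^*_{n+\alpha_d}\,\psi_{n-\beta_d-1}\cdots\psi_{n-\beta_1-1},$$ and $b(\lambda)=\sum_{i=1}^{d}(\beta_i+1)$. Let $t=(t_1,t_2,\dots)$ be arbitrary elements of $R$, and let $$J_k=\sum_{j\in\mathbb Z}\psi_j\psi^*_{j+k}\ (k\ne 0),\qquad J_-(t)=\sum_{k\ge1}t_kJ_{-k},\qquad J_+(t)=\sum_{k\ge1}t_kJ_k .$$ Define $h_k(t)$ by $\exp\big(\sum_{k\ge1}t_kz^k\big)=\sum_{k\ge0}h_k(t)z^k$, with $h_k=0$ for $k<0$, and the Schur polynomials by $s_\lambda(t)=\det_{1\le i,j\le\ell(\lambda)}h_{\lambda_i-i+j}(t)$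 (so $s_\emptyset=1$). Then for every $n\in\mathbb Z$ $$e^{J_-(t)}|n\rangle=\sum_{\lambda}(-1)^{b(\lambda)}s_\lambda(t)\,|\lambda,n\rangle,\qquad \langle n|e^{J_+(t)}=\sum_{\lambda}(-1)^{b(\lambda)}s_\lambda(t)\,\langle\lambda,n|,$$ where the sums run over all Young diagrams including the empty one. All infinite sums of states are formal: for every basis state only finitely many terms contribute to its coefficient. Equivalently, for every $n\in\mathbb Z$ and every Young diagram $\lambda$, $$\langle\lambda,n|e^{J_-(t)}|n\rangle=(-1)^{b(\lambda)}s_\lambda(t),\qquad \langle n|e^{J_+(t)}|\lambda,n\rangle=(-1)^{b(\lambda)}s_\lambda(t).$$ -/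

import Mathlib

namespace FermiFock

/-! ### The fermionic Fock space -/

/-- A Maya diagram: the set `occ` of occupied modes of a basis state of the fermionic Fock space.
Almost all negative modes are occupied and almost all non-negative modes are empty. -/
@[ext]
structure Maya where
  occ : Set ℤ
  finite_particles : {k : ℤ | k ∈ occ ∧ 0 ≤ k}.Finite
  finite_holes : {k : ℤ | k ∉ occ ∧ k < 0}.Finite

namespace Maya

/-- Fill the mode `k`. -/
def insert (S : Maya) (k : ℤ) : Maya where
  occ := Insert.insert k S.occ
  finite_particles := (S.finite_particles.insert k).subset (by
    rintro x ⟨hx | hx, h0⟩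
    · exact Or.inl hx
    · exact Or.inr ⟨hx, h0⟩)
  finite_holes := S.finite_holes.subset (by
    rintro x ⟨hx, h0⟩
    exact ⟨fun h => hx (Or.inr h), h0⟩)

/-- Empty the mode `k`. -/
def erase (S : Maya) (k : ℤ) : Maya where
  occ := S.occ \ {k}
  finite_particles := S.finite_particles.subset (by
    rintro x ⟨hx, h0⟩
    exact ⟨hx.1, h0⟩)
  finite_holes := (S.finite_holes.insert k).subset (by
    rintro x ⟨hx, h0⟩
    by_cases h : x = k
    · exact Or.inl h
    · exact Or.inr ⟨fun h' => hx ⟨h', h⟩, h0⟩)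

/-- The Dirac sea: exactly the negative modes are occupied. -/
def dirac : Maya where
  occ := Set.Iio 0
  finite_particles := Set.finite_empty.subset (by
    rintro x ⟨hx, h0⟩
    exact absurd hx (not_lt.mpr h0))
  finite_holes := Set.finite_empty.subset (by
    rintro x ⟨hx, h0⟩
    exact absurd h0 hx)

/-- The (finite) number of occupied modes above `k`. -/
noncomputable def above (S : Maya) (k : ℤ) : ℕ := {s : ℤ | s ∈ S.occ ∧ k < s}.ncard

end Maya

/-- Kets: formal (possibly infinite) linear combinations `∑ v S |S⟩` of the basis kets `|S⟩`,
where `|S⟩` is the wedge product of the occupied modes in decreasing order. -/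
abbrev Ket (R : Type*) := Maya → R

/-- Bras: formal (possibly infinite) linear combinations `∑ U S ⟨S|` of the dual basis. -/
abbrev Bra (R : Type*) := Maya → R

section Fermions

variable {R : Type*} [CommRing R]

open Classical in
/-- `ψ_k v`. On basis kets: `ψ_k |T⟩ = (-1)^(number of s ∈ T with s > k) |T ∪ {k}⟩` if `k ∉ T`,
and `ψ_k |T⟩ = 0` if `k ∈ T`. -/
noncomputable def psiKet (k : ℤ) (v : Ket R) : Ket R := fun S =>
  if k ∈ S.occ then (-1) ^ S.above k * v (S.erase k) else 0

open Classical in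
/-- `ψ*_k v`. On basis kets: `ψ*_k |T⟩ = (-1)^(number of s ∈ T with s > k) |T \ {k}⟩` if `k ∈ T`,
and `ψ*_k |T⟩ = 0` if `k ∉ T`. -/
noncomputable def psiStarKet (k : ℤ) (v : Ket R) : Ket R := fun S =>
  if k ∈ S.occ then 0 else (-1) ^ S.above k * v (S.insert k)

open Classical in
/-- The right action `U ψ_k` on bras: `(U ψ_k)|S⟩ = U (ψ_k |S⟩)`. -/
noncomputable def psiBra (U : Bra R) (k : ℤ) : Bra R := fun S =>
  if k ∈ S.occ then 0 else (-1) ^ S.above k * U (S.insert k)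

open Classical in
/-- The right action `U ψ*_k` on bras: `(U ψ*_k)|S⟩ = U (ψ*_k |S⟩)`. -/
noncomputable def psiStarBra (U : Bra R) (k : ℤ) : Bra R := fun S =>
  if k ∈ S.occ then (-1) ^ S.above k * U (S.erase k) else 0

/-- The pairing `⟨U|V⟩` for which the basis kets `|S⟩` and the bras `⟨S|` are dual to each other.
It is used only where one of `U`, `V` has finite support. -/
noncomputable def pairing (U : Bra R) (V : Ket R) : R := ∑ᶠ S : Maya, U S * V S

open Classical in
/-- The Dirac vacuum `|0⟩`. -/
noncomputable def ketZero : Ket R := fun S => if S = Maya.dirac then 1 else 0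

open Classical in
/-- The dual Dirac vacuum `⟨0|`. -/
noncomputable def braZero : Bra R := fun S => if S = Maya.dirac then 1 else 0

end Fermions

/-- The symbols `ψ_k` and `ψ*_k`. -/
inductive Fermion
  | psi (k : ℤ)
  | psiStar (k : ℤ)

section States

variable {R : Type*} [CommRing R]

/-- Left action of `ψ_k`, `ψ*_k` on kets. -/
noncomputable def Fermion.ket : Fermion → Ket R → Ket R
  | .psi k, v => psiKet k v
  | .psiStar k, v => psiStarKet k v

/-- Right action of `ψ_k`, `ψ*_k` on bras. -/
noncomputable def Fermion.bra (U : Bra R) : Fermion → Bra R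
  | .psi k => psiBra U k
  | .psiStar k => psiStarBra U k

/-- `f₁ f₂ ⋯ f_r v` (the rightmost factor acts first). -/
noncomputable def wordKet (w : List Fermion) (v : Ket R) : Ket R := w.foldr Fermion.ket v

/-- `U f₁ f₂ ⋯ f_r` (the leftmost factor acts first). -/
noncomputable def wordBra (U : Bra R) (w : List Fermion) : Bra R := w.foldl Fermion.bra U

/-- The shifted vacuum `|n⟩`: it is `ψ_{n-1} ⋯ ψ_1 ψ_0 |0⟩` for `n ≥ 0` and
`ψ*_n ⋯ ψ*_{-2} ψ*_{-1} |0⟩` for `n < 0`. -/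
noncomputable def ketVac (n : ℤ) : Ket R :=
  if 0 ≤ n then
    wordKet ((List.range n.toNat).map fun i => Fermion.psi i).reverse ketZero
  else
    wordKet ((List.range (-n).toNat).map fun i => Fermion.psiStar (-i - 1)).reverse ketZero

/-- The shifted dual vacuum `⟨n|`: it is `⟨0| ψ*_0 ψ*_1 ⋯ ψ*_{n-1}` for `n ≥ 0` and
`⟨0| ψ_{-1} ψ_{-2} ⋯ ψ_n` for `n < 0`. -/
noncomputable def braVac (n : ℤ) : Bra R :=
  if 0 ≤ n then
    wordBra braZero ((List.range n.toNat).map fun i => Fermion.psiStar i)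
  else
    wordBra braZero ((List.range (-n).toNat).map fun i => Fermion.psi (-i - 1))

/-! ### Frobenius coordinates and the basis states -/

/-- `d(μ)`, the number of boxes on the main diagonal. -/
def diagLen (μ : YoungDiagram) : ℕ := (μ.cells.filter fun c => c.1 = c.2).card

/-- The Frobenius coordinate `α_{i+1} = μ_{i+1} - (i+1)`, for `i < d(μ)`
(rows are counted from `0` by `rowLen`, and the subtraction does not truncate for `i < d(μ)`). -/
def frobAlpha (μ : YoungDiagram) (i : ℕ) : ℕ := μ.rowLen i - (i + 1)

/-- The Frobenius coordinate `β_{i+1} = μ'_{i+1} - (i+1)`, for `i < d(μ)`. -/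
def frobBeta (μ : YoungDiagram) (i : ℕ) : ℕ := μ.colLen i - (i + 1)

/-- `b(μ) = ∑_{i=1}^{d(μ)} (β_i + 1)`. -/
def bNum (μ : YoungDiagram) : ℕ := ∑ i ∈ Finset.range (diagLen μ), (frobBeta μ i + 1)

/-- `|μ, n⟩ = ψ*_{n-β_1-1} ⋯ ψ*_{n-β_d-1} ψ_{n+α_d} ⋯ ψ_{n+α_1} |n⟩`. -/
noncomputable def ketState (μ : YoungDiagram) (n : ℤ) : Ket R :=
  wordKet
    (((List.range (diagLen μ)).map fun i => Fermion.psiStar (n - frobBeta μ i - 1)) ++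
      ((List.range (diagLen μ)).map fun i => Fermion.psi (n + frobAlpha μ i)).reverse)
    (ketVac n)

/-- `⟨μ, n| = ⟨n| ψ*_{n+α_1} ⋯ ψ*_{n+α_d} ψ_{n-β_d-1} ⋯ ψ_{n-β_1-1}`. -/
noncomputable def braState (μ : YoungDiagram) (n : ℤ) : Bra R :=
  wordBra (braVac n)
    (((List.range (diagLen μ)).map fun i => Fermion.psiStar (n + frobAlpha μ i)) ++
      ((List.range (diagLen μ)).map fun i => Fermion.psi (n - frobBeta μ i - 1)).reverse)

/-! ### Currents and coherent states -/

/-- `J_k v = ∑_j ψ_j ψ*_{j+k} v`, used for `k ≠ 0` only (no normal ordering is needed then). -/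
noncomputable def currentKet (k : ℤ) (v : Ket R) : Ket R := fun S =>
  ∑ᶠ j : ℤ, psiKet j (psiStarKet (j + k) v) S

/-- `U J_k = ∑_j U ψ_j ψ*_{j+k}`, used for `k ≠ 0` only. -/
noncomputable def currentBra (U : Bra R) (k : ℤ) : Bra R := fun S =>
  ∑ᶠ j : ℤ, psiStarBra (psiBra U j) (j + k) S

/-- `J_-(t) v = ∑_{k ≥ 1} t_k J_{-k} v`. -/
noncomputable def JMinus (t : ℕ → R) (v : Ket R) : Ket R := fun S =>
  ∑ᶠ k : ℕ, t (k + 1) * currentKet (-((k : ℤ) + 1)) v S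

/-- `U J_+(t) = ∑_{k ≥ 1} t_k U J_k`. -/
noncomputable def JPlus (t : ℕ → R) (U : Bra R) : Bra R := fun S =>
  ∑ᶠ k : ℕ, t (k + 1) * currentBra U ((k : ℤ) + 1) S

/-- `e^{J_-(t)} v = ∑_m (1 / m!) J_-(t)^m v`. -/
noncomputable def expJMinus [Algebra ℚ R] (t : ℕ → R) (v : Ket R) : Ket R := fun S =>
  ∑ᶠ m : ℕ, ((m.factorial : ℚ)⁻¹) • ((JMinus t)^[m] v) S

/-- `U e^{J_+(t)} = ∑_m (1 / m!) U J_+(t)^m`. -/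
noncomputable def expJPlus [Algebra ℚ R] (t : ℕ → R) (U : Bra R) : Bra R := fun S =>
  ∑ᶠ m : ℕ, ((m.factorial : ℚ)⁻¹) • ((JPlus t)^[m] U) S

/-- The formal series `∑ i, f i` of kets (or bras) converges to `a`: for every basis state only
finitely many terms contribute to its coefficient, and these add up to the coefficient in `a`. -/
def IsFormalSum {ι : Type*} (f : ι → Maya → R) (a : Maya → R) : Prop :=
  ∀ S : Maya, (Function.support fun i => f i S).Finite ∧ ∑ᶠ i, f i S = a S

/-! ### Schur polynomials -/

/-- `ξ(t, z) = ∑_{k ≥ 1} t_k z^k`. -/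
noncomputable def xi (t : ℕ → R) : PowerSeries R := PowerSeries.mk fun k => if k = 0 then 0 else t k

/-- `h_k(t)` for `k : ℤ`, where `exp (ξ(t, z)) = ∑_{k ≥ 0} h_k(t) z^k` and `h_k = 0` for `k < 0`. -/
noncomputable def hPoly [Algebra ℚ R] (t : ℕ → R) (k : ℤ) : R :=
  if 0 ≤ k then PowerSeries.coeff k.toNat ((PowerSeries.exp R).subst (xi t)) else 0

/-- The Schur polynomial `s_μ(t) = det_{1 ≤ i, j ≤ ℓ(μ)} h_{μ_i - i + j}(t)`. -/
noncomputable def schur [Algebra ℚ R] (μ : YoungDiagram) (t : ℕ → R) : R :=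
  Matrix.det (Matrix.of fun i j : Fin (μ.colLen 0) =>
    hPoly t ((μ.rowLen i : ℤ) - (i : ℕ) + (j : ℕ)))

end States

/-! ### Consistency of the definitions

The operators satisfy the defining relations of the Clifford algebra, the right action on bras is
adjoint to the left action on kets, the vacua have the required properties, the substitution in
the definition of `h_k` is legitimate, and all the infinite sums above are sums with finitely many
non-zero terms. -/

namespace Maya

theorem mem_insert {S : Maya} {k x : ℤ} : x ∈ (S.insert k).occ ↔ x = k ∨ x ∈ S.occ := Iff.rfl

theorem mem_erase {S : Maya} {k x : ℤ} : x ∈ (S.erase k).occ ↔ x ∈ S.occ ∧ x ≠ k := Iff.rfl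

theorem exists_bounds (S : Maya) : ∃ a b : ℤ, (∀ k < a, k ∈ S.occ) ∧ ∀ k ∈ S.occ, k ≤ b := by
  obtain ⟨a, ha⟩ := S.finite_holes.bddBelow
  obtain ⟨b, hb⟩ := S.finite_particles.bddAbove
  refine ⟨min a 0, max b 0, fun k hk => ?_, fun k hk => ?_⟩
  · by_contra h
    have := ha ⟨h, lt_of_lt_of_le hk (min_le_right _ _)⟩
    exact absurd (lt_of_lt_of_le hk (min_le_left _ _)) (not_lt.mpr this)
  · by_contra h
    have h' := max_lt_iff.mp (not_le.mp h)
    exact absurd (hb ⟨hk, h'.2.le⟩) (not_le.mpr h'.1)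

theorem finite_above (S : Maya) (k : ℤ) : {s : ℤ | s ∈ S.occ ∧ k < s}.Finite := by
  obtain ⟨a, b, -, hb⟩ := S.exists_bounds
  exact (Set.finite_Icc k b).subset fun s hs => ⟨hs.2.le, hb s hs.1⟩

theorem above_insert {S : Maya} {m : ℤ} (hm : m ∉ S.occ) (k : ℤ) :
    (S.insert m).above k = S.above k + if k < m then 1 else 0 := by
  unfold above
  split_ifs with h
  · rw [← Set.ncard_insert_of_notMem (a := m) (fun h' => hm h'.1) (S.finite_above k)]
    congr 1
    ext x
    simp only [mem_insert, Set.mem_ofPred_eq, Set.mem_insert_iff]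
    constructor
    · rintro ⟨rfl | hx, hk⟩ <;> tauto
    · rintro (rfl | hx) <;> tauto
  · rw [add_zero]
    congr 1
    ext x
    simp only [mem_insert, Set.mem_ofPred_eq]
    constructor
    · rintro ⟨rfl | hx, hk⟩ <;> tauto
    · tauto

theorem insert_erase {S : Maya} {m : ℤ} (hm : m ∈ S.occ) : (S.erase m).insert m = S := by
  ext x
  simp only [mem_insert, mem_erase]
  by_cases h : x = m
  · subst h; tauto
  · tauto

theorem erase_insert {S : Maya} {m : ℤ} (hm : m ∉ S.occ) : (S.insert m).erase m = S := by
  ext x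
  simp only [mem_insert, mem_erase]
  by_cases h : x = m
  · subst h; tauto
  · tauto

theorem above_erase {S : Maya} {m : ℤ} (hm : m ∈ S.occ) (k : ℤ) :
    S.above k = (S.erase m).above k + if k < m then 1 else 0 := by
  conv_lhs => rw [← insert_erase hm]
  exact above_insert (S := S.erase m) (fun h => (mem_erase.mp h).2 rfl) k

theorem erase_comm (S : Maya) (m k : ℤ) : (S.erase m).erase k = (S.erase k).erase m := by
  ext x
  simp only [mem_erase]
  tauto

theorem insert_comm (S : Maya) (m k : ℤ) : (S.insert m).insert k = (S.insert k).insert m := by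
  ext x
  simp only [mem_insert]
  tauto

theorem insert_erase_comm (S : Maya) {m k : ℤ} (h : m ≠ k) :
    (S.insert m).erase k = (S.erase k).insert m := by
  ext x
  simp only [mem_insert, mem_erase]
  by_cases hx : x = m
  · subst hx; tauto
  · tauto

/-- The energy of a basis state: the sum of `k` over the particles `k ≥ 0` and of `-k` over the
holes `k < 0`. -/
noncomputable def energy (S : Maya) : ℤ := by
  classical
  exact ∑ᶠ k : ℤ, ((if k ∈ S.occ then k else 0) - if k < 0 then k else 0)

theorem energy_nonneg (S : Maya) : 0 ≤ S.energy := by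
  classical
  unfold energy
  refine finsum_nonneg fun k => ?_
  split_ifs <;> omega

theorem energy_move {S : Maya} {i j : ℤ} (hj : j ∈ S.occ) (hi : i ∉ S.occ) :
    ((S.erase j).insert i).energy = S.energy + (i - j) := by
  classical
  have hij : i ≠ j := fun h => hi (h ▸ hj)
  have fin1 : (Function.support fun k : ℤ =>
      ((if k ∈ S.occ then k else 0) - if k < 0 then k else 0)).Finite := by
    refine (S.finite_particles.union S.finite_holes).subset fun k hk => ?_
    simp only [Function.mem_support] at hk
    by_cases h1 : k ∈ S.occ <;> by_cases h2 : k < 0 <;> simp [h1, h2] at hk ⊢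
    omega
  have fin2 : ∀ a : ℤ, (Function.support fun k : ℤ => if k = a then a else 0).Finite := fun a =>
    (Set.finite_singleton a).subset fun k hk => by
      by_contra h
      exact hk (if_neg h)
  have one : ∀ a : ℤ, ∑ᶠ k : ℤ, (if k = a then a else 0) = a := fun a => by
    rw [finsum_eq_single _ a fun k hk => if_neg hk, if_pos rfl]
  have key : i - j = ∑ᶠ k : ℤ, ((if k = i then i else 0) - if k = j then j else 0) := by
    rw [finsum_sub_distrib (fin2 i) (fin2 j), one, one]
  unfold energy
  rw [key, ← finsum_add_distrib fin1]
  · refine finsum_congr fun k => ?_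
    simp only [mem_insert, mem_erase]
    by_cases h1 : k = i
    · subst h1
      simp [hi, hij]
      ring
    · by_cases h2 : k = j
      · subst h2
        simp [hj, h1]
        ring
      · simp [h1, h2]
  · exact ((fin2 i).union (fin2 j)).subset (Function.support_sub _ _)

end Maya

section Consistency

variable {R : Type*} [CommRing R]

theorem psiKet_anticomm (m n : ℤ) (v : Ket R) :
    psiKet m (psiKet n v) + psiKet n (psiKet m v) = 0 := by
  funext S
  by_cases hmn : m = n
  · subst hmn
    simp [psiKet, Maya.mem_erase]
  by_cases hm : m ∈ S.occ
  swap
  · simp [psiKet, hm, Maya.mem_erase]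
  by_cases hn : n ∈ S.occ
  swap
  · simp [psiKet, hn, Maya.mem_erase]
  have e1 := Maya.above_erase hm n
  have e2 := Maya.above_erase hn m
  simp only [psiKet, Pi.add_apply, hm, hn, Maya.mem_erase, Ne.symm hmn, ne_eq, hmn,
    not_false_eq_true, and_self, if_true, Maya.erase_comm S m n, e1, e2, Pi.zero_apply]
  rcases lt_or_gt_of_ne hmn with h | h <;> simp [h, not_lt.mpr h.le, pow_succ] <;> ring

theorem psiStarKet_anticomm (m n : ℤ) (v : Ket R) :
    psiStarKet m (psiStarKet n v) + psiStarKet n (psiStarKet m v) = 0 := by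
  funext S
  by_cases hmn : m = n
  · subst hmn
    simp [psiStarKet, Maya.mem_insert]
  by_cases hm : m ∈ S.occ
  · simp [psiStarKet, hm, Maya.mem_insert]
  by_cases hn : n ∈ S.occ
  · simp [psiStarKet, hn, Maya.mem_insert]
  have e1 := Maya.above_insert hm n
  have e2 := Maya.above_insert hn m
  simp only [psiStarKet, Pi.add_apply, hm, hn, Maya.mem_insert, Ne.symm hmn, hmn,
    or_self, if_false, Maya.insert_comm S m n, e1, e2, Pi.zero_apply]
  rcases lt_or_gt_of_ne hmn with h | h <;> simp [h, not_lt.mpr h.le, pow_succ] <;> ring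

theorem psiKet_psiStarKet_anticomm (m n : ℤ) (v : Ket R) :
    psiKet m (psiStarKet n v) + psiStarKet n (psiKet m v) = if m = n then v else 0 := by
  funext S
  by_cases hmn : m = n
  · subst hmn
    by_cases hm : m ∈ S.occ
    · have e := Maya.above_erase hm m
      simp [psiKet, psiStarKet, hm, Maya.mem_erase, e, Maya.insert_erase hm, ← mul_assoc,
        ← mul_pow]
    · have e := Maya.above_insert hm m
      simp [psiKet, psiStarKet, hm, Maya.mem_insert, e, Maya.erase_insert hm, ← mul_assoc,
        ← mul_pow]
  by_cases hm : m ∈ S.occ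
  swap
  · simp [psiKet, psiStarKet, hm, hmn, Maya.mem_insert]
  by_cases hn : n ∈ S.occ
  · simp [psiKet, psiStarKet, hn, hmn, Maya.mem_erase, Ne.symm hmn]
  have e1 := Maya.above_erase hm n
  have e2 := Maya.above_insert hn m
  simp only [psiKet, psiStarKet, Pi.add_apply, hm, hn, Maya.mem_erase, Maya.mem_insert, hmn,
    or_true, false_and, if_true, if_false, e1, e2, Pi.zero_apply,
    Maya.insert_erase_comm S (Ne.symm hmn)]
  rcases lt_or_gt_of_ne hmn with h | h <;> simp [h, not_lt.mpr h.le, pow_succ] <;> ring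

theorem pairing_psi (U : Bra R) (k : ℤ) (v : Ket R) :
    pairing (psiBra U k) v = pairing U (psiKet k v) := by
  classical
  have h1 : pairing (psiBra U k) v =
      ∑ᶠ S ∈ {S : Maya | k ∉ S.occ}, (-1) ^ S.above k * U (S.insert k) * v S := by
    refine finsum_congr fun S => ?_
    by_cases h : k ∈ S.occ <;> simp [psiBra, h]
  have h2 : pairing U (psiKet k v) =
      ∑ᶠ S ∈ {S : Maya | k ∈ S.occ}, U S * ((-1) ^ S.above k * v (S.erase k)) := by
    refine finsum_congr fun S => ?_
    by_cases h : k ∈ S.occ <;> simp [psiKet, h]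
  rw [h1, h2]
  refine finsum_mem_eq_of_bijOn (fun S => S.insert k) ⟨?_, ?_, ?_⟩ ?_
  · exact fun S _ => Or.inl rfl
  · intro S hS T hT hST
    have := congrArg (fun X => Maya.erase X k) hST
    simpa [Maya.erase_insert (show k ∉ S.occ from hS),
      Maya.erase_insert (show k ∉ T.occ from hT)] using this
  · exact fun S hS => ⟨S.erase k, fun h => h.2 rfl, Maya.insert_erase hS⟩
  · intro S hS
    have hS' : k ∉ S.occ := hS
    simp only [Maya.erase_insert hS', Maya.above_insert hS', lt_irrefl, if_false, add_zero]
    ring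

theorem pairing_psiStar (U : Bra R) (k : ℤ) (v : Ket R) :
    pairing (psiStarBra U k) v = pairing U (psiStarKet k v) := by
  have h := pairing_psi v k U
  simp only [pairing, mul_comm] at h ⊢
  exact h.symm

theorem psi_ketZero {k : ℤ} (hk : k < 0) : psiKet k (ketZero : Ket R) = 0 := by
  funext S
  have : S.erase k ≠ Maya.dirac := fun h =>
    (show k ∉ (S.erase k).occ from fun h => h.2 rfl) (h ▸ hk)
  simp [psiKet, ketZero, this]

theorem psiStar_ketZero {k : ℤ} (hk : 0 ≤ k) : psiStarKet k (ketZero : Ket R) = 0 := by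
  funext S
  have : S.insert k ≠ Maya.dirac := fun h =>
    (show k ∉ Maya.dirac.occ from not_lt.mpr hk) (h ▸ Or.inl rfl)
  simp [psiStarKet, ketZero, this]

theorem braZero_psiStar {k : ℤ} (hk : k < 0) : psiStarBra (braZero : Bra R) k = 0 := psi_ketZero hk

theorem braZero_psi {k : ℤ} (hk : 0 ≤ k) : psiBra (braZero : Bra R) k = 0 := psiStar_ketZero hk

theorem pairing_zero_zero : pairing (braZero : Bra R) ketZero = 1 := by
  unfold pairing
  rw [finsum_eq_single _ Maya.dirac fun S hS => by simp [braZero, hS]]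
  simp [braZero, ketZero]

theorem support_wordKet_finite (w : List Fermion) {v : Ket R} (hv : (Function.support v).Finite) :
    (Function.support (wordKet w v)).Finite := by
  induction w with
  | nil => exact hv
  | cons f w ih =>
    cases f with
    | psi k =>
      refine (ih.image fun S => S.insert k).subset fun S hS => ?_
      change psiKet k (wordKet w v) S ≠ 0 at hS
      by_cases h : k ∈ S.occ
      · simp only [psiKet, h, if_true] at hS
        exact ⟨S.erase k, right_ne_zero_of_mul hS, Maya.insert_erase h⟩
      · simp [psiKet, h] at hS
    | psiStar k =>
      refine (ih.image fun S => S.erase k).subset fun S hS => ?_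
      change psiStarKet k (wordKet w v) S ≠ 0 at hS
      by_cases h : k ∈ S.occ
      · simp [psiStarKet, h] at hS
      · simp only [psiStarKet, h, if_false] at hS
        exact ⟨S.insert k, right_ne_zero_of_mul hS, Maya.erase_insert h⟩

theorem wordBra_eq (w : List Fermion) (U : Bra R) : wordBra U w =
    wordKet (w.map fun | .psi k => Fermion.psiStar k | .psiStar k => Fermion.psi k).reverse U := by
  induction w generalizing U with
  | nil => rfl
  | cons f w ih =>
    have : wordBra U (f :: w) = wordBra (Fermion.bra U f) w := rfl
    rw [this, ih, List.map_cons, List.reverse_cons, wordKet, wordKet, List.foldr_append]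
    cases f <;> rfl

theorem support_ketZero_finite : (Function.support (ketZero : Ket R)).Finite :=
  (Set.finite_singleton Maya.dirac).subset fun S hS => by
    by_contra h
    exact hS (if_neg h)

theorem support_ketState_finite (μ : YoungDiagram) (n : ℤ) :
    (Function.support (ketState μ n : Ket R)).Finite := by
  refine support_wordKet_finite _ ?_
  unfold ketVac
  split_ifs <;> exact support_wordKet_finite _ support_ketZero_finite

theorem support_braState_finite (μ : YoungDiagram) (n : ℤ) :
    (Function.support (braState μ n : Bra R)).Finite := by
  rw [braState, wordBra_eq]
  refine support_wordKet_finite _ ?_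
  unfold braVac
  split_ifs <;> rw [wordBra_eq] <;> exact support_wordKet_finite _ support_ketZero_finite

theorem current_term_ne_zero {i j : ℤ} (hij : i ≠ j) {v : Ket R} {S : Maya}
    (h : psiKet j (psiStarKet i v) S ≠ 0) :
    j ∈ S.occ ∧ i ∉ S.occ ∧ v ((S.erase j).insert i) ≠ 0 := by
  have hj : j ∈ S.occ := by
    by_contra h'
    simp [psiKet, h'] at h
  have hi : i ∉ S.occ := by
    intro h'
    simp [psiKet, psiStarKet, hj, Maya.mem_erase, h', hij] at h
  simp only [psiKet, psiStarKet, hj, Maya.mem_erase, hi, false_and, if_true, if_false] at h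
  exact ⟨hj, hi, right_ne_zero_of_mul (right_ne_zero_of_mul h)⟩

theorem currentKet_finite {k : ℤ} (hk : k ≠ 0) (v : Ket R) (S : Maya) :
    (Function.support fun j : ℤ => psiKet j (psiStarKet (j + k) v) S).Finite := by
  obtain ⟨a, b, ha, hb⟩ := S.exists_bounds
  refine (Set.finite_Icc (a - k) b).subset fun j hj => ?_
  obtain ⟨h1, h2, -⟩ := current_term_ne_zero (by omega) hj
  refine ⟨?_, hb j h1⟩
  by_contra h
  exact h2 (ha _ (by omega))

theorem currentBra_finite {k : ℤ} (hk : k ≠ 0) (U : Bra R) (S : Maya) :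
    (Function.support fun j : ℤ => psiStarBra (psiBra U j) (j + k) S).Finite := by
  obtain ⟨a, b, ha, hb⟩ := S.exists_bounds
  refine (Set.finite_Icc a (b - k)).subset fun j hj => ?_
  obtain ⟨h1, h2, -⟩ := current_term_ne_zero (i := j) (j := j + k) (v := U) (by omega) hj
  refine ⟨?_, by have := hb _ h1; omega⟩
  by_contra h
  exact h2 (ha _ (by omega))

theorem currentBra_apply (U : Bra R) (k : ℤ) : currentBra U k = currentKet (-k) U := by
  funext S
  unfold currentBra currentKet
  conv_rhs => rw [← finsum_comp_equiv (Equiv.addRight k)]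
  refine finsum_congr fun j => ?_
  simp only [Equiv.coe_addRight, add_neg_cancel_right]
  rfl

theorem JPlus_apply (t : ℕ → R) : JPlus t = JMinus t := by
  funext U S
  simp only [JPlus, JMinus, currentBra_apply]

theorem currentKet_ne_zero {k : ℕ} {v : Ket R} {S : Maya}
    (h : currentKet (-((k : ℤ) + 1)) v S ≠ 0) :
    ∃ i j : ℤ, i + k + 1 = j ∧ j ∈ S.occ ∧ i ∉ S.occ ∧ v ((S.erase j).insert i) ≠ 0 := by
  have : ∃ j : ℤ, psiKet j (psiStarKet (j + -((k : ℤ) + 1)) v) S ≠ 0 := by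
    by_contra! h'
    exact h ((finsum_congr h').trans finsum_zero)
  obtain ⟨j, hj⟩ := this
  exact ⟨_, j, by ring, current_term_ne_zero (by omega) hj⟩

theorem JMinus_finite (t : ℕ → R) (v : Ket R) (S : Maya) :
    (Function.support fun k : ℕ => t (k + 1) * currentKet (-((k : ℤ) + 1)) v S).Finite := by
  obtain ⟨a, b, ha, hb⟩ := S.exists_bounds
  refine (Set.finite_Iic (b - a).toNat).subset fun k hk => ?_
  obtain ⟨i, j, hij, hj, hi, -⟩ := currentKet_ne_zero (right_ne_zero_of_mul hk)
  have h1 := hb j hj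
  have h2 : a ≤ i := by
    by_contra h
    exact hi (ha _ (by omega))
  simp only [Set.mem_Iic]
  omega

theorem JPlus_finite (t : ℕ → R) (U : Bra R) (S : Maya) :
    (Function.support fun k : ℕ => t (k + 1) * currentBra U ((k : ℤ) + 1) S).Finite := by
  simpa only [currentBra_apply] using JMinus_finite t U S

theorem JMinus_iterate_ne_zero (t : ℕ → R) (v : Ket R) (m : ℕ) (S : Maya)
    (h : ((JMinus t)^[m] v) S ≠ 0) : (m : ℤ) ≤ S.energy := by
  induction m generalizing S with
  | zero => simpa using S.energy_nonneg
  | succ m ih =>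
    rw [Function.iterate_succ_apply'] at h
    have : ∃ k : ℕ, t (k + 1) * currentKet (-((k : ℤ) + 1)) ((JMinus t)^[m] v) S ≠ 0 := by
      by_contra! h'
      exact h ((finsum_congr h').trans finsum_zero)
    obtain ⟨k, hk⟩ := this
    obtain ⟨i, j, hij, hj, hi, hv⟩ := currentKet_ne_zero (right_ne_zero_of_mul hk)
    have h1 := ih _ hv
    rw [Maya.energy_move hj hi] at h1
    push_cast
    omega

theorem expJMinus_finite [Algebra ℚ R] (t : ℕ → R) (v : Ket R) (S : Maya) :
    (Function.support fun m : ℕ => ((m.factorial : ℚ)⁻¹) • ((JMinus t)^[m] v) S).Finite := by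
  refine (Set.finite_Iic S.energy.toNat).subset fun m hm => ?_
  have h : ((JMinus t)^[m] v) S ≠ 0 := fun h0 => hm (by simp [h0])
  have := JMinus_iterate_ne_zero t v m S h
  simp only [Set.mem_Iic]
  omega

theorem expJPlus_finite [Algebra ℚ R] (t : ℕ → R) (U : Bra R) (S : Maya) :
    (Function.support fun m : ℕ => ((m.factorial : ℚ)⁻¹) • ((JPlus t)^[m] U) S).Finite := by
  rw [JPlus_apply]
  exact expJMinus_finite t U S

theorem hasSubst_xi (t : ℕ → R) : PowerSeries.HasSubst (xi t) :=
  PowerSeries.HasSubst.of_constantCoeff_zero' (by simp [xi])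

theorem mem_diag_iff (μ : YoungDiagram) (i : ℕ) : i < diagLen μ ↔ (i, i) ∈ μ := by
  classical
  have hex : ∃ d, (d, d) ∉ μ := by
    obtain ⟨j, hj⟩ := μ.exists_notMem_row 0
    exact ⟨j, fun h => hj (μ.up_left_mem (Nat.zero_le _) le_rfl h)⟩
  have mem : ∀ a, (a, a) ∈ μ ↔ a < Nat.find hex := fun a => by
    constructor
    · intro h
      by_contra ha
      exact Nat.find_spec hex (μ.up_left_mem (not_lt.mp ha) (not_lt.mp ha) h)
    · exact fun h => not_not.mp (Nat.find_min hex h)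
  have himg : (μ.cells.filter fun c => c.1 = c.2) =
      (Finset.range (Nat.find hex)).image fun a => (a, a) := by
    ext ⟨x, y⟩
    simp only [Finset.mem_filter, YoungDiagram.mem_cells, Finset.mem_image, Finset.mem_range,
      Prod.mk.injEq]
    constructor
    · rintro ⟨h, rfl⟩
      exact ⟨x, (mem x).mp h, rfl, rfl⟩
    · rintro ⟨a, ha, rfl, rfl⟩
      exact ⟨(mem a).mpr ha, rfl⟩
  have hcard : diagLen μ = Nat.find hex := by
    rw [diagLen, himg, Finset.card_image_of_injective _ fun a b h => (Prod.mk.inj h).1,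
      Finset.card_range]
  rw [mem, hcard]

theorem frobAlpha_add (μ : YoungDiagram) {i : ℕ} (hi : i < diagLen μ) :
    frobAlpha μ i + (i + 1) = μ.rowLen i :=
  Nat.sub_add_cancel (YoungDiagram.mem_iff_lt_rowLen.mp ((mem_diag_iff μ i).mp hi))

theorem frobBeta_add (μ : YoungDiagram) {i : ℕ} (hi : i < diagLen μ) :
    frobBeta μ i + (i + 1) = μ.colLen i :=
  Nat.sub_add_cancel (YoungDiagram.mem_iff_lt_colLen.mp ((mem_diag_iff μ i).mp hi))

end Consistency

end FermiFock

/-! A Young diagram `μ` and a charge `n` give the Maya diagram with occupied modes `n + μ_i - i`,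
and `ketState_eq` shows that `|μ, n⟩` is this basis ket up to the sign `(-1)^b`. Both expansions
therefore amount to computing the coefficients of `e^{J_-(t)}|n⟩` in the basis. Bras and kets are
both functions on Maya diagrams, and transposition exchanges `ψ_k` with `ψ*_k` and `J_k` with
`J_{-k}`, so the bra half is literally the ket half.

To find the coefficient at `S`, choose a window `[a, b]` such that `S` is full below `a` and empty
above `b`. Since `J_-(t)` lets coefficients at `S` depend only on states in the same window, it may
be replaced by a finite quadratic operator (`JMinus_eq_bilin`). That operator kills the vacuum of
charge `a` and acts as a derivation on products of fermion fields (`bilin_mul_field`). Writing `|n⟩`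
as a wedge of `N = n - a` unit vectors over that vacuum, its exponential should act on each factor
separately and turn the mode `c` into `∑ h_{m-c}(t) ψ_m`.

This is proved as an evolution equation: with `h_k(X t)` in `R[X]`, the wedge satisfies `dW/dX = B
W` (`derivative_wedge`) with initial value `|n⟩`, so its coefficients are `B^m |n⟩ / m!`
(`coeff_wedge`), and `X = 1` gives the exponential. The coefficients of a wedge are determinants
(`wedge_ofTuple`), here the Jacobi–Trudi ones. A wedge has a definite charge, so only diagrams
coming from partitions occur (`exists_ofYoung_of_wedge_ne_zero`). -/

namespace FermiFock

open Polynomial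

/-! ### Fermions acting on basis kets -/

section BasisStates

variable {R : Type*} [CommRing R]

open Classical in
/-- The basis ket `|T⟩`. -/
noncomputable def ketOf (T : Maya) : Ket R := fun S => if S = T then 1 else 0

theorem psiKet_smul (k : ℤ) (c : R) (v : Ket R) : psiKet k (c • v) = c • psiKet k v := by
  funext S
  by_cases h : k ∈ S.occ <;> simp [psiKet, h, mul_left_comm]

theorem psiStarKet_smul (k : ℤ) (c : R) (v : Ket R) :
    psiStarKet k (c • v) = c • psiStarKet k v := by
  funext S
  by_cases h : k ∈ S.occ <;> simp [psiStarKet, h, mul_left_comm]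

theorem psiKet_add (k : ℤ) (v w : Ket R) : psiKet k (v + w) = psiKet k v + psiKet k w := by
  funext S
  by_cases h : k ∈ S.occ <;> simp [psiKet, h, mul_add]

theorem psiStarKet_add (k : ℤ) (v w : Ket R) :
    psiStarKet k (v + w) = psiStarKet k v + psiStarKet k w := by
  funext S
  by_cases h : k ∈ S.occ <;> simp [psiStarKet, h, mul_add]

theorem wordKet_smul (w : List Fermion) (c : R) (v : Ket R) :
    wordKet w (c • v) = c • wordKet w v := by
  induction w with
  | nil => rfl
  | cons f w ih =>
    change Fermion.ket f (wordKet w (c • v)) = c • Fermion.ket f (wordKet w v)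
    rw [ih]
    cases f
    · exact psiKet_smul _ _ _
    · exact psiStarKet_smul _ _ _

theorem wordKet_append (w w' : List Fermion) (v : Ket R) :
    wordKet (w ++ w') v = wordKet w (wordKet w' v) := List.foldr_append ..

theorem psiKet_ketOf {k : ℤ} {T : Maya} (h : k ∉ T.occ) :
    psiKet k (ketOf T : Ket R) = (-1 : R) ^ T.above k • ketOf (T.insert k) := by
  funext S
  by_cases hS : k ∈ S.occ
  · by_cases hT : S = T.insert k
    · subst hT
      simp [psiKet, ketOf, Maya.mem_insert, Maya.erase_insert h, Maya.above_insert h]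
    · have : S.erase k ≠ T := fun h' => hT (by rw [← h', Maya.insert_erase hS])
      simp [psiKet, ketOf, this, hT]
  · have : S ≠ T.insert k := fun h' => hS (h' ▸ Or.inl rfl)
    simp [psiKet, ketOf, this, hS]

theorem psiStarKet_ketOf {k : ℤ} {T : Maya} (h : k ∈ T.occ) :
    psiStarKet k (ketOf T : Ket R) = (-1 : R) ^ T.above k • ketOf (T.erase k) := by
  funext S
  by_cases hS : k ∈ S.occ
  · have : S ≠ T.erase k := fun h' => (Maya.mem_erase.mp (h' ▸ hS)).2 rfl
    simp [psiStarKet, ketOf, this, hS]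
  · by_cases hT : S = T.erase k
    · subst hT
      simp [psiStarKet, ketOf, Maya.mem_erase, Maya.insert_erase h, Maya.above_erase h k]
    · have : S.insert k ≠ T := fun h' => hT (by rw [← h', Maya.erase_insert hS])
      simp [psiStarKet, ketOf, this, hS, hT]

theorem psiStarKet_ketOf_of_notMem {k : ℤ} {T : Maya} (h : k ∉ T.occ) :
    psiStarKet k (ketOf T : Ket R) = 0 := by
  funext S
  have : S.insert k ≠ T := fun h' => h (h' ▸ Or.inl rfl)
  simp [psiStarKet, ketOf, this]

end BasisStates

/-- The Maya diagram of the shifted vacuum: exactly the modes below `n` are occupied. -/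
def Maya.vac (n : ℤ) : Maya where
  occ := Set.Iio n
  finite_particles := (Set.finite_Icc 0 n).subset fun _ hx => ⟨hx.2, (Set.mem_Iio.mp hx.1).le⟩
  finite_holes := (Set.finite_Icc n 0).subset fun _ hx => ⟨not_lt.mp hx.1, hx.2.le⟩

theorem Maya.mem_vac {n x : ℤ} : x ∈ (Maya.vac n).occ ↔ x < n := Iff.rfl

theorem Maya.vac_insert (n : ℤ) : (Maya.vac n).insert n = Maya.vac (n + 1) := by
  ext x
  simp only [Maya.mem_insert, Maya.mem_vac]
  omega

theorem Maya.vac_erase (n : ℤ) : (Maya.vac (n + 1)).erase n = Maya.vac n := by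
  ext x
  simp only [Maya.mem_erase, Maya.mem_vac]
  omega

theorem Maya.above_vac (n k : ℤ) : (Maya.vac n).above k = (n - 1 - k).toNat := by
  have : {s : ℤ | s ∈ (Maya.vac n).occ ∧ k < s} = ↑(Finset.Ioo k n) := by
    ext x
    simp only [Maya.mem_vac, Finset.coe_Ioo, Set.mem_Ioo, Set.mem_ofPred_eq]
    omega
  rw [Maya.above, this, Set.ncard_coe_finset, Int.card_Ioo]
  congr 1
  omega

/-! ### Shifted vacua, and transposing bras into kets -/

section Vacua

variable {R : Type*} [CommRing R]

theorem psiKet_vac (n : ℤ) : psiKet n (ketOf (Maya.vac n) : Ket R) = ketOf (Maya.vac (n + 1)) := by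
  rw [psiKet_ketOf (by simp [Maya.mem_vac]), Maya.above_vac, Maya.vac_insert]
  simp

theorem psiStarKet_vac (n : ℤ) :
    psiStarKet n (ketOf (Maya.vac (n + 1)) : Ket R) = ketOf (Maya.vac n) := by
  rw [psiStarKet_ketOf (by simp [Maya.mem_vac]), Maya.above_vac, Maya.vac_erase]
  simp

/-- No sign appears because every operator in the word acts at the Fermi level, with no occupied
mode above it. -/
theorem ketVac_eq (n : ℤ) : (ketVac n : Ket R) = ketOf (Maya.vac n) := by
  have pos : ∀ m : ℕ, wordKet ((List.range m).map fun i : ℕ => Fermion.psi i).reverse ketZero =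
      (ketOf (Maya.vac m) : Ket R) := fun m => by
    induction m with
    | zero => rfl
    | succ m ih =>
      rw [List.range_succ, List.map_append, List.reverse_append, wordKet_append, ih]
      exact (psiKet_vac (m : ℤ)).trans (by push_cast; rfl)
  have neg : ∀ m : ℕ,
      wordKet ((List.range m).map fun i : ℕ => Fermion.psiStar (-i - 1)).reverse ketZero =
      (ketOf (Maya.vac (-m)) : Ket R) := fun m => by
    induction m with
    | zero => rfl
    | succ m ih =>
      rw [List.range_succ, List.map_append, List.reverse_append, wordKet_append, ih]
      have := psiStarKet_vac (R := R) (-m - 1)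
      rw [sub_add_cancel] at this
      refine this.trans ?_
      congr 2
      push_cast
      ring
  -- In `ketVac` the index `i` is an integer, so the list of naturals is coerced to integers in
  -- monadic form; this restores an ordinary `map`.
  have cast : ∀ l : List ℕ, (do let a ← l; pure (a : ℤ)) = l.map Nat.cast := fun l => by
    simp [List.map_eq_flatMap]
  unfold ketVac
  rw [cast, cast, List.map_map, List.map_map]
  split_ifs with h
  · refine (pos _).trans ?_
    rw [ Int.toNat_of_nonneg h]
  · refine (neg _).trans ?_
    rw [Int.toNat_of_nonneg (by omega), neg_neg]

/-- Transposing the word reverses it and exchanges `ψ` with `ψ*`, which is exactly how the two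
definitions differ. -/
theorem braVac_eq (n : ℤ) : (braVac n : Bra R) = ketVac n := by
  unfold braVac ketVac
  split_ifs
  · rw [wordBra_eq, List.map_map]; rfl
  · rw [wordBra_eq, List.map_map]; rfl

theorem braState_eq (μ : YoungDiagram) (n : ℤ) : (braState μ n : Bra R) = ketState μ n := by
  rw [braState, ketState, wordBra_eq, braVac_eq, List.map_append, List.reverse_append,
    List.map_reverse, List.reverse_reverse, List.map_map, List.map_map]
  rfl

theorem expJPlus_eq [Algebra ℚ R] (t : ℕ → R) : expJPlus t = expJMinus t := by
  funext U S
  simp only [expJPlus, expJMinus, JPlus_apply]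

end Vacua

/-! ### The Maya diagram of a Young diagram -/

theorem rowLen_sub_strictAnti (μ : YoungDiagram) (n : ℤ) :
    StrictAnti fun i : ℕ => n + μ.rowLen i - i - 1 := fun i j hij => by
  have := μ.rowLen_anti i j hij.le
  simp only
  omega

theorem rowLen_eq_zero {μ : YoungDiagram} {i : ℕ} (h : μ.colLen 0 ≤ i) : μ.rowLen i = 0 := by
  by_contra h'
  have := YoungDiagram.mem_iff_lt_colLen.mp
    (YoungDiagram.mem_iff_lt_rowLen.mpr (Nat.pos_of_ne_zero h'))
  omega

/-- The Maya diagram of charge `n` that belongs to `μ`, with occupied modes `n + μ_i - i`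
for `i = 1, 2, …`. -/
def Maya.ofYoung (μ : YoungDiagram) (n : ℤ) : Maya where
  occ := Set.range fun i : ℕ => n + μ.rowLen i - i - 1
  finite_particles := ((Set.finite_Iic (n + μ.rowLen 0).toNat).image _).subset (by
    rintro _ ⟨⟨i, rfl⟩, h⟩
    refine ⟨i, ?_, rfl⟩
    have := μ.rowLen_anti 0 i (Nat.zero_le _)
    simp only [Set.mem_Iic]
    simp only at h
    omega)
  finite_holes := (Set.finite_Icc (n - μ.colLen 0) 0).subset (by
    rintro x ⟨hx, h0⟩
    refine ⟨?_, h0.le⟩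
    by_contra h
    refine hx ⟨(n - 1 - x).toNat, ?_⟩
    have := rowLen_eq_zero (μ := μ) (i := (n - 1 - x).toNat) (by omega)
    simp only [this]
    omega)

theorem Maya.ofYoung_injective (n : ℤ) : Function.Injective fun μ => Maya.ofYoung μ n := by
  intro μ ν h
  -- A strictly monotone sequence is determined by its range; the order dual makes the decreasing
  -- modes increasing.
  have h1 : (fun i : ℕ => OrderDual.toDual (n + μ.rowLen i - i - 1)) =
      fun i : ℕ => OrderDual.toDual (n + ν.rowLen i - i - 1) := by
    refine (StrictMono.range_inj ?_ ?_).mp ?_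
    · exact fun i j hij => rowLen_sub_strictAnti μ n hij
    · exact fun i j hij => rowLen_sub_strictAnti ν n hij
    · exact congrArg Maya.occ h
  ext ⟨i, j⟩
  have h2 : n + μ.rowLen i - i - 1 = n + ν.rowLen i - i - 1 := congrFun h1 i
  rw [YoungDiagram.mem_cells, YoungDiagram.mem_cells, YoungDiagram.mem_iff_lt_rowLen,
    YoungDiagram.mem_iff_lt_rowLen]
  omega

theorem exists_rowLen_eq {r : ℕ → ℕ} (hr : Antitone r) {N : ℕ} (hN : ∀ i, N ≤ i → r i = 0) :
    ∃ μ : YoungDiagram, ∀ i, μ.rowLen i = r i := by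
  let μ : YoungDiagram :=
    { cells := (Finset.range N ×ˢ Finset.range (r 0)).filter fun c => c.2 < r c.1
      isLowerSet := by
        rintro ⟨i, j⟩ ⟨i', j'⟩ h hc
        obtain ⟨h1, h2⟩ : i' ≤ i ∧ j' ≤ j := h
        simp only [Finset.coe_filter, Finset.mem_product, Finset.mem_range,
          Set.mem_ofPred_eq] at hc ⊢
        have := hr h1
        omega }
  refine ⟨μ, fun i => ?_⟩
  have key : ∀ j, j < μ.rowLen i ↔ j < r i := fun j => by
    rw [← YoungDiagram.mem_iff_lt_rowLen]
    change (i, j) ∈ (Finset.range N ×ˢ Finset.range (r 0)).filter (fun c => c.2 < r c.1) ↔ _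
    simp only [Finset.mem_filter, Finset.mem_product, Finset.mem_range, and_iff_right_iff_imp]
    intro h
    have h0 := hr (Nat.zero_le i)
    refine ⟨?_, by omega⟩
    by_contra h'
    have := hN i (by omega)
    omega
  have h1 := key (r i)
  have h2 := key (μ.rowLen i)
  omega

/-- A row `i` beyond the diagonal and a column `j` on the diagonal never yield the same mode. -/
theorem row_ne_col (μ : YoungDiagram) (i j : ℕ) :
    (i : ℤ) - μ.rowLen i ≠ μ.colLen j - j - 1 := by
  have h1 := YoungDiagram.mem_iff_lt_rowLen (μ := μ) (i := i) (j := j)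
  have h2 := YoungDiagram.mem_iff_lt_colLen (μ := μ) (i := i) (j := j)
  by_cases h : (i, j) ∈ μ
  · have := h1.mp h
    have := h2.mp h
    omega
  · have := mt h1.mpr h
    have := mt h2.mpr h
    omega

/-- The sequence `i - μ_i` is strictly increasing. Take the first row `i` where it reaches `x`; if
it jumps over `x`, then column `i - 1 - x` ends exactly at row `i - 1`, and this column accounts for
`x`. -/
theorem exists_row_or_col (μ : YoungDiagram) (x : ℕ) :
    (∃ i : ℕ, (x : ℤ) = i - μ.rowLen i) ∨
      ∃ j : ℕ, j < diagLen μ ∧ (x : ℤ) = μ.colLen j - j - 1 := by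
  classical
  have hex : ∃ i : ℕ, (x : ℤ) ≤ i - μ.rowLen i := by
    refine ⟨x + μ.rowLen 0, ?_⟩
    have := μ.rowLen_anti 0 (x + μ.rowLen 0) (Nat.zero_le _)
    omega
  have h1 := Nat.find_spec hex
  have h2 : ∀ i < Nat.find hex, ¬ (x : ℤ) ≤ i - μ.rowLen i := fun i hi => Nat.find_min hex hi
  generalize Nat.find hex = i at h1 h2
  by_cases h : (x : ℤ) = i - μ.rowLen i
  · exact Or.inl ⟨i, h⟩
  · right
    have h3 := h2 (i - 1) (by omega)
    have h4 : (i - 1, i - 1 - x) ∈ μ := YoungDiagram.mem_iff_lt_rowLen.mpr (by omega)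
    have h5 : (i, i - 1 - x) ∉ μ := fun h' => by
      have := YoungDiagram.mem_iff_lt_rowLen.mp h'
      omega
    have h6 := YoungDiagram.mem_iff_lt_colLen.mp h4
    have h7 := mt YoungDiagram.mem_iff_lt_colLen.mpr h5
    refine ⟨i - 1 - x, (mem_diag_iff _ _).mpr (μ.up_left_mem (by omega) le_rfl h4), ?_⟩
    omega

theorem frobAlpha_add_cast (μ : YoungDiagram) {i : ℕ} (hi : i < diagLen μ) :
    (frobAlpha μ i : ℤ) = μ.rowLen i - i - 1 := by
  have := frobAlpha_add μ hi
  omega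

theorem frobBeta_add_cast (μ : YoungDiagram) {i : ℕ} (hi : i < diagLen μ) :
    (frobBeta μ i : ℤ) = μ.colLen i - i - 1 := by
  have := frobBeta_add μ hi
  omega

theorem diagLen_le_rowLen_iff (μ : YoungDiagram) (i : ℕ) : diagLen μ ≤ i ↔ μ.rowLen i ≤ i := by
  have := mem_diag_iff μ i
  rw [YoungDiagram.mem_iff_lt_rowLen] at this
  omega

/-- Rows meeting the diagonal give the particles; later rows give modes below `n`. `row_ne_col`
keeps all of them off the holes, and `exists_row_or_col` shows that every other mode below `n` is
occupied. -/
theorem mem_ofYoung_iff (μ : YoungDiagram) (n x : ℤ) : x ∈ (Maya.ofYoung μ n).occ ↔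
    (x < n ∨ ∃ i < diagLen μ, x = n + frobAlpha μ i) ∧
      ∀ i < diagLen μ, x ≠ n - frobBeta μ i - 1 := by
  constructor
  · rintro ⟨i, rfl⟩
    simp only
    refine ⟨?_, fun j hj h => ?_⟩
    · by_cases h : i < diagLen μ
      · exact Or.inr ⟨i, h, by rw [frobAlpha_add_cast μ h]; ring⟩
      · have := (diagLen_le_rowLen_iff μ i).mp (not_lt.mp h)
        left; omega
    · rw [frobBeta_add_cast μ hj] at h
      have := row_ne_col μ i j
      omega
  · rintro ⟨h | ⟨i, hi, rfl⟩, h2⟩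
    · rcases exists_row_or_col μ (n - 1 - x).toNat with ⟨i, hi⟩ | ⟨j, hj, hx⟩
      · exact ⟨i, by simp only; omega⟩
      · refine absurd ?_ (h2 j hj)
        rw [frobBeta_add_cast μ hj]
        omega
    · exact ⟨i, by simp only; rw [frobAlpha_add_cast μ hi]; ring⟩

/-! ### The basis states `|μ, n⟩` -/

/-- The vacuum of charge `n` with the first `r` particles of `μ` added. -/
noncomputable def Maya.withParticles (μ : YoungDiagram) (n : ℤ) : ℕ → Maya
  | 0 => Maya.vac n
  | r + 1 => (Maya.withParticles μ n r).insert (n + frobAlpha μ r)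

theorem mem_withParticles (μ : YoungDiagram) (n x : ℤ) (r : ℕ) :
    x ∈ (Maya.withParticles μ n r).occ ↔ x < n ∨ ∃ i < r, x = n + frobAlpha μ i := by
  induction r with
  | zero => simp [Maya.withParticles, Maya.mem_vac]
  | succ r ih =>
    rw [Maya.withParticles, Maya.mem_insert, ih]
    simp only [Nat.lt_succ_iff_lt_or_eq, or_and_right, exists_or, exists_eq_left]
    rw [or_comm, or_assoc]

theorem notMem_withParticles {μ : YoungDiagram} {r : ℕ} (n : ℤ) (hr : r < diagLen μ) :
    n + frobAlpha μ r ∉ (Maya.withParticles μ n r).occ := by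
  rw [mem_withParticles]
  rintro (h | ⟨i, hi, h⟩)
  · omega
  · rw [frobAlpha_add_cast μ hr, frobAlpha_add_cast μ (hi.trans hr)] at h
    have := rowLen_sub_strictAnti μ n hi
    simp only at this
    omega

theorem above_withParticles (μ : YoungDiagram) (n k : ℤ) {r : ℕ} (hr : r ≤ diagLen μ)
    (hk : ∀ i < r, k < n + frobAlpha μ i) :
    (Maya.withParticles μ n r).above k = (n - 1 - k).toNat + r := by
  induction r with
  | zero => exact Maya.above_vac n k
  | succ r ih =>
    rw [Maya.withParticles, Maya.above_insert (notMem_withParticles n hr), ih (by omega)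
      fun i hi => hk i (by omega), if_pos (hk r (by omega)), add_assoc]

section BasisStates

variable {R : Type*} [CommRing R]

/-- The `α_i` decrease, so the particle with index `i` enters below the `i` particles already
present and above the sea, which costs `(-1)^i`. -/
theorem wordKet_particles (μ : YoungDiagram) (n : ℤ) {r : ℕ} (hr : r ≤ diagLen μ) :
    wordKet ((List.range r).map fun i => Fermion.psi (n + frobAlpha μ i)).reverse (ketVac n : Ket R) =
      (-1 : R) ^ (∑ i ∈ Finset.range r, i) •
        (ketOf (Maya.withParticles μ n r) : Ket R) := by
  induction r with
  | zero => rw [ketVac_eq]; simp [wordKet, Maya.withParticles]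
  | succ r ih =>
    rw [List.range_succ, List.map_append, List.reverse_append, wordKet_append, ih (by omega),
      wordKet_smul]
    change _ • psiKet (n + frobAlpha μ r) (ketOf (Maya.withParticles μ n r)) = _
    rw [psiKet_ketOf (notMem_withParticles n hr), above_withParticles μ n _ (by omega), smul_smul,
      Finset.sum_range_succ, show (n - 1 - (n + frobAlpha μ r)).toNat = 0 by omega, zero_add,
      ← pow_add]
    · rfl
    · intro i hi
      rw [frobAlpha_add_cast μ hr, frobAlpha_add_cast μ (hi.trans hr)]
      have := rowLen_sub_strictAnti μ n hi
      simp only at this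
      omega

/-- The Maya diagram of `μ` with the first `r` holes filled. -/
noncomputable def Maya.fillHoles (μ : YoungDiagram) (n : ℤ) : ℕ → Maya
  | 0 => Maya.ofYoung μ n
  | r + 1 => (Maya.fillHoles μ n r).insert (n - frobBeta μ r - 1)

theorem mem_fillHoles (μ : YoungDiagram) (n x : ℤ) (r : ℕ) : x ∈ (Maya.fillHoles μ n r).occ ↔
    x ∈ (Maya.ofYoung μ n).occ ∨ ∃ i < r, x = n - frobBeta μ i - 1 := by
  induction r with
  | zero => simp [Maya.fillHoles]
  | succ r ih =>
    rw [Maya.fillHoles, Maya.mem_insert, ih]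
    simp only [Nat.lt_succ_iff_lt_or_eq, or_and_right, exists_or, exists_eq_left]
    rw [or_comm, or_assoc]

theorem frobBeta_lt {μ : YoungDiagram} {i j : ℕ} (hij : i < j) (hj : j < diagLen μ) :
    frobBeta μ j < frobBeta μ i := by
  have := frobBeta_add μ hj
  have := frobBeta_add μ (hij.trans hj)
  have := μ.colLen_anti i j hij.le
  omega

theorem notMem_fillHoles {μ : YoungDiagram} {r : ℕ} (n : ℤ) (hr : r < diagLen μ) :
    n - frobBeta μ r - 1 ∉ (Maya.fillHoles μ n r).occ := by
  rw [mem_fillHoles, mem_ofYoung_iff]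
  rintro (h | ⟨i, hi, h⟩)
  · exact h.2 r hr rfl
  · have := frobBeta_lt hi hr
    omega

theorem fillHoles_diagLen (μ : YoungDiagram) (n : ℤ) :
    Maya.fillHoles μ n (diagLen μ) = Maya.withParticles μ n (diagLen μ) := by
  ext x
  rw [mem_fillHoles, mem_ofYoung_iff, mem_withParticles]
  constructor
  · rintro (h | ⟨i, hi, rfl⟩)
    · exact h.1
    · left; omega
  · intro h
    by_cases h' : ∃ i < diagLen μ, x = n - frobBeta μ i - 1
    · exact Or.inr h'
    · push Not at h'
      exact Or.inl ⟨h, h'⟩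

theorem above_fillHoles_sub {μ : YoungDiagram} (n : ℤ) {r m : ℕ}
    (hm : r < m) (hm' : m ≤ diagLen μ) :
    (Maya.fillHoles μ n m).above (n - frobBeta μ r - 1) =
      (Maya.fillHoles μ n (r + 1)).above (n - frobBeta μ r - 1) + (m - (r + 1)) := by
  induction m, hm using Nat.le_induction with
  | base => simp
  | succ m hm ih =>
    have := frobBeta_lt hm hm'
    rw [Maya.fillHoles, Maya.above_insert (notMem_fillHoles n hm'), ih (by omega),
      if_pos (by omega)]
    simp only [Nat.succ_eq_add_one] at hm
    omega

/-- With all holes filled the count is `β_r + d`: the `β_r` sea modes above the hole and the `d`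
particles. The `d - (r + 1)` holes with larger index lie higher and are still empty here. -/
theorem above_fillHoles {μ : YoungDiagram} (n : ℤ) {r : ℕ} (hr : r < diagLen μ) :
    (Maya.fillHoles μ n (r + 1)).above (n - frobBeta μ r - 1) = frobBeta μ r + (r + 1) := by
  have h1 := above_fillHoles_sub n hr le_rfl
  rw [fillHoles_diagLen, above_withParticles μ n _ le_rfl fun i _ => by omega] at h1
  omega

theorem wordKet_holes (μ : YoungDiagram) (n : ℤ) {r : ℕ} (hr : r ≤ diagLen μ) :
    wordKet ((List.range r).map fun i => Fermion.psiStar (n - frobBeta μ i - 1))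
      (ketOf (Maya.fillHoles μ n r) : Ket R) =
      (-1 : R) ^ (∑ i ∈ Finset.range r, (frobBeta μ i + (i + 1))) •
        (ketOf (Maya.ofYoung μ n) : Ket R) := by
  induction r with
  | zero => simp [wordKet, Maya.fillHoles]
  | succ r ih =>
    rw [List.range_succ, List.map_append, wordKet_append]
    change wordKet _ (psiStarKet (n - frobBeta μ r - 1) (ketOf (Maya.fillHoles μ n (r + 1)))) = _
    rw [psiStarKet_ketOf (by rw [mem_fillHoles]; exact Or.inr ⟨r, by omega, rfl⟩),
      above_fillHoles n hr, wordKet_smul, Maya.fillHoles, Maya.erase_insert (notMem_fillHoles n hr),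
      ih (by omega), smul_smul, Finset.sum_range_succ, pow_add _ (∑ i ∈ _, _), mul_comm]

theorem ketState_eq (μ : YoungDiagram) (n : ℤ) :
    (ketState μ n : Ket R) = (-1 : R) ^ bNum μ • ketOf (Maya.ofYoung μ n) := by
  rw [ketState, wordKet_append, wordKet_particles μ n le_rfl, wordKet_smul, ← fillHoles_diagLen,
    wordKet_holes μ n le_rfl, smul_smul, ← pow_add, ← Finset.sum_add_distrib, bNum]
  congr 1
  rw [← Finset.prod_pow_eq_pow_sum, ← Finset.prod_pow_eq_pow_sum]
  refine Finset.prod_congr rfl fun i _ => ?_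
  -- The particle sign `i` and the hole sign `β_i + i + 1` combine to `β_i + 1` modulo 2.
  rw [show i + (frobBeta μ i + (i + 1)) = (frobBeta μ i + 1) + 2 * i by ring, pow_add, pow_mul]
  simp

end BasisStates

/-! ### Finite truncations of the current and wedge products -/

section Operators

variable {R : Type*} [CommRing R]

/-- `ψ_k` as a linear endomorphism of the space of kets. -/
noncomputable def psiEnd (k : ℤ) : Module.End R (Ket R) where
  toFun := psiKet k
  map_add' := psiKet_add k
  map_smul' := psiKet_smul k

/-- `ψ*_k` as a linear endomorphism of the space of kets. -/
noncomputable def psiStarEnd (k : ℤ) : Module.End R (Ket R) where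
  toFun := psiStarKet k
  map_add' := psiStarKet_add k
  map_smul' := psiStarKet_smul k

theorem psiEnd_anticomm (m n : ℤ) : psiEnd m * psiEnd n + psiEnd n * psiEnd m =
    (0 : Module.End R (Ket R)) := LinearMap.ext fun v => psiKet_anticomm m n v

theorem psiEnd_psiStarEnd_anticomm (m n : ℤ) : psiEnd m * psiStarEnd n + psiStarEnd n * psiEnd m =
    if m = n then 1 else (0 : Module.End R (Ket R)) := LinearMap.ext fun v => by
  refine (psiKet_psiStarKet_anticomm m n v).trans ?_
  split_ifs <;> rfl

/-- The fermion field `∑_{m ∈ I} f(m) ψ_m`. -/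
noncomputable def field (I : Finset ℤ) (f : ℤ → R) : Module.End R (Ket R) :=
  ∑ m ∈ I, f m • psiEnd m

/-- The bilinear operator `∑_{j, i ∈ I} τ(j, i) ψ_j ψ*_i`. -/
noncomputable def bilin (I : Finset ℤ) (τ : ℤ → ℤ → R) : Module.End R (Ket R) :=
  ∑ j ∈ I, ∑ i ∈ I, τ j i • (psiEnd j * psiStarEnd i)

/-- Moving `ψ_m` to the left past `ψ*_i` and `ψ_j` gives two signs that cancel, and one contraction
with `ψ*_i`. -/
theorem psi_psiStar_mul_psi (j i m : ℤ) : psiEnd j * psiStarEnd i * psiEnd m =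
    (if m = i then psiEnd j else 0) + psiEnd m * (psiEnd j * psiStarEnd i : Module.End R (Ket R)) := by
  have h1 := congrArg (· * psiStarEnd i) (psiEnd_anticomm (R := R) m j)
  have h2 := congrArg (psiEnd j * ·) (psiEnd_psiStarEnd_anticomm (R := R) m i)
  simp only [add_mul, mul_add, mul_ite, mul_one, mul_zero, zero_mul, mul_assoc] at h1 h2 ⊢
  refine add_left_cancel (a := psiEnd j * (psiEnd m * psiStarEnd i)) ?_
  rw [h2, add_left_comm, add_comm (psiEnd j * _), h1, add_zero]

/-- The commutator with a field is the field of the transformed one-particle function; this is the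
Leibniz rule used along a wedge. -/
theorem bilin_mul_field (I : Finset ℤ) (τ : ℤ → ℤ → R) (f : ℤ → R) :
    bilin I τ * field I f =
      field I (fun j => ∑ i ∈ I, τ j i * f i) + field I f * bilin I τ := by
  simp only [bilin, field, Finset.sum_mul, Finset.mul_sum, smul_mul_smul_comm, psi_psiStar_mul_psi,
    smul_add, Finset.sum_add_distrib]
  congr 1
  · rw [Finset.sum_comm]
    refine Finset.sum_congr rfl fun j _ => ?_
    rw [Finset.sum_smul, Finset.sum_comm]
    refine Finset.sum_congr rfl fun i hi => ?_
    rw [Finset.sum_eq_single_of_mem i hi, if_pos rfl]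
    intro m _ hm
    rw [if_neg hm, smul_zero]
  · rw [Finset.sum_comm]
    refine Finset.sum_congr rfl fun j _ => Finset.sum_comm.trans ?_
    refine Finset.sum_congr rfl fun i _ => Finset.sum_congr rfl fun m _ => ?_
    rw [mul_comm (f m)]

theorem psiEnd_apply (k : ℤ) (v : Ket R) : psiEnd k v = psiKet k v := rfl

theorem field_apply (I : Finset ℤ) (f : ℤ → R) (v : Ket R) (S : Maya) :
    field I f v S = ∑ m ∈ I, f m * psiKet m v S := by
  simp [field, psiEnd_apply]

theorem bilin_apply (I : Finset ℤ) (τ : ℤ → ℤ → R) (v : Ket R) (S : Maya) :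
    bilin I τ v S = ∑ j ∈ I, ∑ i ∈ I, τ j i * psiKet j (psiStarKet i v) S := by
  simp [bilin]
  rfl

/-- The wedge product of the `N` functions `m ↦ g (m - (a + N - 1)), …, m ↦ g (m - a)`
with the vacuum of charge `a`. -/
noncomputable def wedge (I : Finset ℤ) (a : ℤ) (g : ℤ → R) : ℕ → Ket R
  | 0 => ketOf (Maya.vac a)
  | N + 1 => field I (fun m => g (m - (a + N))) (wedge I a g N)

end Operators

/-- The Maya diagram in which, beside all modes below `a`, the modes in `A` are occupied. -/
def Maya.addSet (a : ℤ) (A : Finset ℤ) : Maya where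
  occ := Set.Iio a ∪ A
  finite_particles := ((Set.finite_Icc 0 a).union A.finite_toSet).subset (by
    rintro x ⟨hx | hx, h0⟩
    · exact Or.inl ⟨h0, (Set.mem_Iio.mp hx).le⟩
    · exact Or.inr hx)
  finite_holes := (Set.finite_Icc a 0).subset (by
    rintro x ⟨hx, h0⟩
    exact ⟨not_lt.mp fun h => hx (Or.inl h), h0.le⟩)

theorem Maya.mem_addSet {a x : ℤ} {A : Finset ℤ} :
    x ∈ (Maya.addSet a A).occ ↔ x < a ∨ x ∈ A := Iff.rfl

/-- The Maya diagram in which, beside all modes below `a`, the modes `s i` are occupied. -/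
def Maya.ofTuple (a : ℤ) {N : ℕ} (s : Fin N → ℤ) : Maya := Maya.addSet a (Finset.univ.image s)

theorem Maya.mem_ofTuple {a x : ℤ} {N : ℕ} {s : Fin N → ℤ} :
    x ∈ (Maya.ofTuple a s).occ ↔ x < a ∨ ∃ i, s i = x := by
  simp [Maya.ofTuple, Maya.mem_addSet]

theorem Maya.above_ofTuple {a : ℤ} {N : ℕ} {s : Fin N → ℤ} (hs : StrictAnti s) (i : Fin N)
    (hi : a ≤ s i) : (Maya.ofTuple a s).above (s i) = i := by
  have : {x : ℤ | x ∈ (Maya.ofTuple a s).occ ∧ s i < x} = ↑((Finset.Iio i).image s) := by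
    ext x
    simp only [Maya.mem_ofTuple, Finset.coe_image, Finset.coe_Iio, Set.mem_image, Set.mem_Iio,
      Set.mem_ofPred_eq]
    constructor
    · rintro ⟨h | ⟨j, rfl⟩, h'⟩
      · omega
      · exact ⟨j, hs.lt_iff_gt.mp h', rfl⟩
    · rintro ⟨j, hj, rfl⟩
      exact ⟨Or.inr ⟨j, rfl⟩, hs hj⟩
  rw [Maya.above, this, Set.ncard_coe_finset, Finset.card_image_of_injective _ hs.injective,
    Fin.card_Iio]

theorem Maya.erase_ofTuple {a : ℤ} {N : ℕ} {s : Fin (N + 1) → ℤ} (hs : StrictAnti s)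
    (i : Fin (N + 1)) (hi : a ≤ s i) :
    (Maya.ofTuple a s).erase (s i) = Maya.ofTuple a (s ∘ i.succAbove) := by
  ext x
  simp only [Maya.mem_erase, Maya.mem_ofTuple, Function.comp_apply]
  constructor
  · rintro ⟨h | ⟨j, rfl⟩, h'⟩
    · exact Or.inl h
    · obtain ⟨k, rfl⟩ := Fin.exists_succAbove_eq (x := j) (y := i) fun h => h' (h ▸ rfl)
      exact Or.inr ⟨k, rfl⟩
  · rintro (h | ⟨k, rfl⟩)
    · exact ⟨Or.inl h, by omega⟩
    · exact ⟨Or.inr ⟨i.succAbove k, rfl⟩, fun h => Fin.succAbove_ne i k (hs.injective h)⟩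

/-! ### Coefficients and support of wedge products -/

section Wedge

variable {R : Type*} [CommRing R]

/-- Laplace expansion along the first column, which belongs to the outermost field. If that field
fills `s i`, exactly `i` occupied modes lie above, so the fermionic sign is the cofactor sign. -/
theorem wedge_ofTuple {a b : ℤ} {g : ℤ → R} {N : ℕ} {s : Fin N → ℤ} (hs : StrictAnti s)
    (ha : ∀ i, a ≤ s i) (hb : ∀ i, s i ≤ b) :
    wedge (Finset.Icc a b) a g N (Maya.ofTuple a s) =
      Matrix.det (Matrix.of fun i j : Fin N => g (s i - (a + N - 1 - (j : ℕ)))) := by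
  induction N with
  | zero =>
    have : Maya.ofTuple a s = Maya.vac a := by
      ext x
      simp [Maya.mem_ofTuple, Maya.mem_vac]
    simp [wedge, ketOf, this]
  | succ N ih =>
    have hsub : Finset.univ.image s ⊆ Finset.Icc a b := fun x hx => by
      obtain ⟨i, -, rfl⟩ := Finset.mem_image.mp hx
      exact Finset.mem_Icc.mpr ⟨ha i, hb i⟩
    rw [wedge, field_apply, Matrix.det_succ_column_zero, ← Finset.sum_subset hsub,
      Finset.sum_image hs.injective.injOn]
    · refine Finset.sum_congr rfl fun i _ => ?_
      rw [psiKet, if_pos (Maya.mem_ofTuple.mpr (Or.inr ⟨i, rfl⟩)), Maya.above_ofTuple hs i (ha i),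
        Maya.erase_ofTuple hs i (ha i),
        ih (s := s ∘ i.succAbove) (hs.comp_strictMono (Fin.strictMono_succAbove i))
          (fun j => ha _) fun j => hb _, mul_left_comm, ← mul_assoc]
      congr 2
      · simp [← add_assoc]
      · ext j k
        simp only [Matrix.of_apply, Function.comp_apply, Matrix.submatrix_apply, Fin.val_succ]
        congr 1
        push_cast
        ring
    · intro m hm hm'
      rw [psiKet, if_neg, mul_zero]
      rw [Maya.ofTuple, Maya.mem_addSet]
      rintro (h | h)
      · have := (Finset.mem_Icc.mp hm).1
        omega
      · exact hm' h

theorem exists_addSet_of_wedge_ne_zero {a b : ℤ} {g : ℤ → R} {N : ℕ} {S : Maya}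
    (h : wedge (Finset.Icc a b) a g N S ≠ 0) :
    ∃ A : Finset ℤ, A.card = N ∧ (∀ x ∈ A, a ≤ x) ∧ S = Maya.addSet a A := by
  induction N generalizing S with
  | zero =>
    refine ⟨∅, rfl, by simp, ?_⟩
    have : S = Maya.vac a := by
      by_contra h'
      exact h (if_neg h')
    rw [this]
    ext x
    simp [Maya.mem_vac, Maya.mem_addSet]
  | succ N ih =>
    rw [wedge, field_apply] at h
    obtain ⟨m, hm, hne⟩ := Finset.exists_ne_zero_of_sum_ne_zero h
    have hmS : m ∈ S.occ := by
      by_contra h'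
      simp [psiKet, h'] at hne
    simp only [psiKet, hmS, if_true] at hne
    obtain ⟨A, hA, ha, hS⟩ := ih (right_ne_zero_of_mul (right_ne_zero_of_mul hne))
    have hmA : m ∉ A := fun h' => by
      have : m ∈ (S.erase m).occ := hS ▸ Or.inr h'
      exact this.2 rfl
    refine ⟨Insert.insert m A, by rw [Finset.card_insert_of_notMem hmA, hA], ?_, ?_⟩
    · intro x hx
      rcases Finset.mem_insert.mp hx with rfl | hx
      · exact (Finset.mem_Icc.mp hm).1
      · exact ha x hx
    · rw [← Maya.insert_erase hmS, hS]
      ext x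
      simp only [Maya.mem_insert, Maya.mem_addSet, Finset.mem_insert]
      tauto

/-- Charge conservation: `S` has exactly `N` modes beside the sea below `a`. Listed downwards, their
excesses over `a + N - 1, a + N - 2, …` form a partition. -/
theorem exists_ofYoung_of_wedge_ne_zero {a b : ℤ} {g : ℤ → R} {N : ℕ} {S : Maya}
    (h : wedge (Finset.Icc a b) a g N S ≠ 0) :
    ∃ μ : YoungDiagram, S = Maya.ofYoung μ (a + N) := by
  obtain ⟨A, hA, ha, rfl⟩ := exists_addSet_of_wedge_ne_zero h
  let e := A.orderEmbOfFin hA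
  -- the gaps below the occupied modes, from the highest mode on
  let r : ℕ → ℕ := fun i => if hi : i < N then (e (Fin.rev ⟨i, hi⟩) - (a + N - 1 - i)).toNat else 0
  have hstep : ∀ k (hk : k + 1 < N), e ⟨k, by omega⟩ < e ⟨k + 1, hk⟩ := fun k hk =>
    e.strictMono (by simp)
  have hlow : ∀ k (hk : k < N), a + k ≤ e ⟨k, hk⟩ := fun k => by
    induction k with
    | zero => exact fun hk => by simpa using ha _ (A.orderEmbOfFin_mem hA _)
    | succ k ih =>
      intro hk
      have := ih (by omega)
      have := hstep k hk
      push_cast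
      omega
  -- By `hlow` the excess is nonnegative, so `toNat` in `r` does not truncate.
  have hr_eq : ∀ i (hi : i < N), (r i : ℤ) = e ⟨N - (i + 1), by omega⟩ - (a + N - 1 - i) :=
    fun i hi => by
      have := hlow (N - (i + 1)) (by omega)
      simp only [r, dif_pos hi, Fin.rev]
      omega
  have hr : Antitone r := antitone_nat_of_succ_le fun i => by
    by_cases hi : i + 1 < N
    · have h1 := hr_eq i (by omega)
      have h2 := hr_eq (i + 1) hi
      have h3 := hstep (N - (i + 1 + 1)) (by omega)
      have h4 : (⟨N - (i + 1 + 1) + 1, by omega⟩ : Fin N) = ⟨N - (i + 1), by omega⟩ := by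
        ext; simp only; omega
      rw [h4] at h3
      push_cast at h2
      omega
    · simp [r, hi]
  obtain ⟨μ, hμ⟩ := exists_rowLen_eq hr (N := N) fun i hi => dif_neg (by omega)
  refine ⟨μ, ?_⟩
  ext x
  rw [Maya.mem_addSet]
  constructor
  · rintro (hx | hx)
    · refine ⟨(a + N - 1 - x).toNat, ?_⟩
      have : r (a + N - 1 - x).toNat = 0 := dif_neg (by omega)
      simp only [hμ, this]
      omega
    · obtain ⟨k, rfl⟩ : x ∈ Set.range e := by
        rw [Finset.range_orderEmbOfFin]; exact hx
      refine ⟨N - (k + 1), ?_⟩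
      have h1 := hr_eq (N - (k + 1)) (by omega)
      have h2 : (⟨N - (N - (k + 1) + 1), by omega⟩ : Fin N) = k := by
        ext; simp only; omega
      rw [h2] at h1
      simp only [hμ, h1]
      omega
  · rintro ⟨i, rfl⟩
    simp only [hμ]
    by_cases hi : i < N
    · right
      rw [hr_eq i hi]
      convert A.orderEmbOfFin_mem hA ⟨N - (i + 1), by omega⟩ using 1
      ring_nf
      rfl
    · left
      have : r i = 0 := dif_neg hi
      rw [this]
      omega

end Wedge

/-! ### The deformation `t ↦ X t` -/

section Deformation

variable {R : Type*} [CommRing R]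

theorem coeff_xi_pow_eq_zero (t : ℕ → R) {k m : ℕ} (h : k < m) :
    PowerSeries.coeff k (xi t ^ m) = 0 := by
  refine PowerSeries.X_pow_dvd_iff.mp (pow_dvd_pow_of_dvd ?_ m) k h
  rw [PowerSeries.X_dvd_iff]
  simp [xi]

variable [Algebra ℚ R]

/-- The polynomial `h_k(X t)` in the deformation parameter `X`. -/
noncomputable def hDeform (t : ℕ → R) (k : ℤ) : R[X] :=
  if 0 ≤ k then ∑ m ∈ Finset.range (k.toNat + 1),
    monomial m ((m.factorial : ℚ)⁻¹ • PowerSeries.coeff k.toNat (xi t ^ m)) else 0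

theorem hDeform_of_neg (t : ℕ → R) {k : ℤ} (hk : k < 0) : hDeform t k = 0 := if_neg (by omega)

theorem coeff_hDeform (t : ℕ → R) (k m : ℕ) : (hDeform t k).coeff m =
    (m.factorial : ℚ)⁻¹ • PowerSeries.coeff k (xi t ^ m) := by
  rw [hDeform, if_pos (by omega), Int.toNat_natCast, Polynomial.finsetSum_coeff]
  simp only [coeff_monomial, Finset.sum_ite_eq', Finset.mem_range]
  split_ifs with h
  · rfl
  -- Since `ξ` has no constant term, powers `m > k` do not contribute; this is why `h_k(X t)` is a
  -- polynomial in `X`.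
  · rw [coeff_xi_pow_eq_zero t (by omega), smul_zero]

theorem eval_one_hDeform (t : ℕ → R) (k : ℤ) : (hDeform t k).eval 1 = hPoly t k := by
  unfold hDeform hPoly
  split_ifs
  · rw [PowerSeries.coeff_subst' (hasSubst_xi t), Polynomial.eval_finsetSum,
      finsum_eq_finsetSum_of_support_subset (s := Finset.range (k.toNat + 1))]
    · refine Finset.sum_congr rfl fun m _ => ?_
      rw [eval_monomial, one_pow, mul_one, PowerSeries.coeff_exp, one_div, algebraMap_smul]
    · intro m hm
      by_contra h
      refine hm ?_
      simp only
      rw [coeff_xi_pow_eq_zero t (by simpa using h), smul_zero]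
  · exact eval_zero

theorem coeff_zero_hDeform (t : ℕ → R) (k : ℤ) :
    (hDeform t k).coeff 0 = if k = 0 then 1 else 0 := by
  rcases lt_or_ge k 0 with h | h
  · rw [hDeform_of_neg t h, if_neg (by omega), coeff_zero]
  · lift k to ℕ using h
    simp [coeff_hDeform, PowerSeries.coeff_one]

theorem smul_factorial_succ (m : ℕ) (x : R) :
    ((m : R) + 1) * (((m + 1).factorial : ℚ)⁻¹ • x) = (m.factorial : ℚ)⁻¹ • x := by
  have h1 : ((m : R) + 1) = algebraMap ℚ R (m + 1) := by simp
  rw [h1, ← Algebra.smul_def, smul_smul]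
  congr 1
  have := Nat.factorial_ne_zero m
  rw [Nat.factorial_succ]
  push_cast
  field_simp

/-- This is `d/dX exp(X ξ) = ξ exp(X ξ)`, read off in degree `k` of `z`. -/
theorem derivative_hDeform (t : ℕ → R) (k : ℕ) : derivative (hDeform t k) =
    ∑ p ∈ Finset.HasAntidiagonal.antidiagonal k, if p.1 = 0 then 0 else C (t p.1) * hDeform t p.2 := by
  ext m
  rw [coeff_derivative, coeff_hDeform, mul_comm, smul_factorial_succ, pow_succ',
    PowerSeries.coeff_mul, Finset.smul_sum, Polynomial.finsetSum_coeff]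
  refine Finset.sum_congr rfl fun p _ => ?_
  rw [xi, PowerSeries.coeff_mk, ← xi]
  split_ifs
  · simp
  · rw [coeff_C_mul, coeff_hDeform, mul_smul_comm]

end Deformation

/-! ### Truncation of the current to a finite window -/

section Truncation

variable {R : Type*} [CommRing R]

/-- The matrix of the one-particle operator `∑_{k ≥ 1} t_k Λ^k`, where `Λ` raises the mode by one. -/
def shiftMatrix (t : ℕ → R) (j i : ℤ) : R := if i < j then t (j - i).toNat else 0

/-- Every `ψ*_i` in the window has `i ≥ a` and meets an empty mode. -/
theorem bilin_shiftMatrix_vac (t : ℕ → R) (a b : ℤ) :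
    bilin (Finset.Icc a b) (shiftMatrix t) (ketOf (Maya.vac a)) = 0 := by
  funext S
  rw [bilin_apply]
  refine Finset.sum_eq_zero fun j _ => Finset.sum_eq_zero fun i hi => ?_
  rw [psiStarKet_ketOf_of_notMem, show psiKet j (0 : Ket R) = 0 from map_zero (psiEnd j)]
  · simp
  · rw [Maya.mem_vac]
    have := (Finset.mem_Icc.mp hi).1
    omega

theorem derivative_psiKet (m : ℤ) (v : Ket R[X]) :
    (fun S => derivative (psiKet m v S)) = psiKet m fun S => derivative (v S) := by
  funext S
  by_cases h : m ∈ S.occ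
  · simp only [psiKet, h, if_true]
    rcases neg_one_pow_eq_or R[X] (S.above m) with e | e <;> simp [e]
  · simp [psiKet, h]

theorem derivative_field (I : Finset ℤ) (f : ℤ → R[X]) (v : Ket R[X]) :
    (fun S => derivative (field I f v S)) =
      field I (fun m => derivative (f m)) v + field I f fun S => derivative (v S) := by
  funext S
  simp only [field_apply, Pi.add_apply, derivative_sum, derivative_mul, Finset.sum_add_distrib]
  congr 1
  refine Finset.sum_congr rfl fun m _ => ?_
  rw [← congrFun (derivative_psiKet m v) S]

theorem coeff_neg_one_pow_mul (k d : ℕ) (p : R[X]) :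
    ((-1) ^ k * p).coeff d = (-1) ^ k * p.coeff d := by
  rcases k.even_or_odd with h | h <;> simp [h.neg_one_pow]

theorem coeff_psiKet (d : ℕ) (m : ℤ) (v : Ket R[X]) (S : Maya) :
    (psiKet m v S).coeff d = psiKet m (fun T => (v T).coeff d) S := by
  by_cases h : m ∈ S.occ <;> simp [psiKet, h, coeff_neg_one_pow_mul]

theorem coeff_psiStarKet (d : ℕ) (m : ℤ) (v : Ket R[X]) (S : Maya) :
    (psiStarKet m v S).coeff d = psiStarKet m (fun T => (v T).coeff d) S := by
  by_cases h : m ∈ S.occ <;> simp [psiStarKet, h, coeff_neg_one_pow_mul]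

theorem coeff_bilin (I : Finset ℤ) (t : ℕ → R) (d : ℕ) (v : Ket R[X]) (S : Maya) :
    (bilin I (shiftMatrix fun k => C (t k)) v S).coeff d =
      bilin I (shiftMatrix t) (fun T => (v T).coeff d) S := by
  simp only [bilin_apply, finsetSum_coeff]
  refine Finset.sum_congr rfl fun j _ => Finset.sum_congr rfl fun i _ => ?_
  rw [shiftMatrix, shiftMatrix]
  split_ifs
  · rw [coeff_C_mul, coeff_psiKet]
    simp only [coeff_psiStarKet]
  · simp

theorem coeff_zero_field (I : Finset ℤ) (f : ℤ → R[X]) (v : Ket R[X]) (S : Maya) :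
    (field I f v S).coeff 0 = field I (fun m => (f m).coeff 0) (fun T => (v T).coeff 0) S := by
  simp only [field_apply, finsetSum_coeff, mul_coeff_zero, coeff_psiKet]

/-- The locality of `J_-(t)`: on states between the vacua of charges `a` and `b + 1` it
agrees with its truncation to the modes in `[a, b]`. -/
theorem JMinus_eq_bilin (t : ℕ → R) {a b : ℤ} {v w : Ket R}
    (h : ∀ S : Maya, (∀ k < a, k ∈ S.occ) → (∀ k ∈ S.occ, k ≤ b) → v S = w S) (S : Maya)
    (ha : ∀ k < a, k ∈ S.occ) (hb : ∀ k ∈ S.occ, k ≤ b) :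
    JMinus t v S = bilin (Finset.Icc a b) (shiftMatrix t) w S := by
  -- The state consulted is `S` with a particle moved from `j` down to an empty mode `i`. As `S` is
  -- full below `a`, the target satisfies `i ≥ a`, so the new state obeys the same bounds.
  have loc : ∀ i j : ℤ, i < j → psiKet j (psiStarKet i v) S = psiKet j (psiStarKet i w) S := by
    intro i j hij
    by_cases hj : j ∈ S.occ
    · by_cases hi : i ∈ S.occ
      · simp [psiKet, psiStarKet, hj, Maya.mem_erase, hi, hij.ne]
      · simp only [psiKet, psiStarKet, hj, Maya.mem_erase, hi, false_and, if_true, if_false]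
        rw [h]
        · intro k hk
          refine Or.inr ⟨ha k hk, ?_⟩
          have : ¬ i < a := fun h' => hi (ha i h')
          simp only [Set.mem_singleton_iff]
          omega
        · rintro k (rfl | hk)
          · have := hb j hj
            omega
          · exact hb k hk.1
    · simp [psiKet, hj]
  have zero : ∀ i j : ℤ, i < j → (i < a ∨ j ∉ Finset.Icc a b) →
      psiKet j (psiStarKet i w) S = 0 := by
    intro i j hij h'
    by_contra hne
    obtain ⟨h1, h2, -⟩ := current_term_ne_zero hij.ne hne
    have h3 := hb j h1
    have h4 : ¬ i < a := fun h' => h2 (ha i h')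
    rw [Finset.mem_Icc] at h'
    omega
  have hcur : ∀ k : ℕ, currentKet (-((k : ℤ) + 1)) v S =
      ∑ j ∈ Finset.Icc a b, psiKet j (psiStarKet (j - (k + 1)) w) S := fun k => by
    rw [currentKet, finsum_eq_finsetSum_of_support_subset (s := Finset.Icc a b)]
    · refine Finset.sum_congr rfl fun j _ => ?_
      rw [← sub_eq_add_neg]
      exact loc _ _ (by omega)
    · intro j hj
      by_contra h'
      refine hj ?_
      simp only
      rw [← sub_eq_add_neg, loc _ _ (by omega)]
      exact zero _ _ (by omega) (Or.inr h')
  -- The shift is by `k + 1`, and a move inside `[a, b]` has length at most `b - a`, hence `k < b -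
  -- a`.
  rw [JMinus, bilin_apply, finsum_eq_finsetSum_of_support_subset
    (s := Finset.range (b - a).toNat)]
  · simp only [hcur, Finset.mul_sum]
    rw [Finset.sum_comm]
    refine Finset.sum_congr rfl fun j hj => ?_
    rw [Finset.mem_Icc] at hj
    refine Finset.sum_bij_ne_zero (fun k _ _ => j - (k + 1)) ?_ ?_ ?_ ?_
    · intro k _ hne
      rw [Finset.mem_Icc]
      by_contra h'
      refine hne ?_
      rw [zero _ _ (by omega) (by omega), mul_zero]
    · intro k _ _ k' _ _ hk
      omega
    · intro i hi hne
      rw [Finset.mem_Icc] at hi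
      have hij : i < j := by
        by_contra h'
        simp [shiftMatrix, h'] at hne
      refine ⟨(j - i - 1).toNat, by rw [Finset.mem_range]; omega, ?_, by omega⟩
      rw [shiftMatrix, if_pos hij] at hne
      convert hne using 3 <;> [omega; (congr 1; omega)]
    · intro k _ _
      rw [shiftMatrix, if_pos (by omega)]
      congr 2
      omega
  · intro k hk
    by_contra h'
    refine hk ?_
    simp only [hcur]
    rw [Finset.sum_eq_zero, mul_zero]
    intro j hj
    rw [Finset.mem_Icc] at hj
    refine zero _ _ (by omega) (Or.inl ?_)
    simp only [Finset.coe_range, Set.mem_Iio] at h'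
    omega

theorem JMinus_iterate_eq_bilin (t : ℕ → R) {a b : ℤ} (v : Ket R) (m : ℕ) (S : Maya)
    (ha : ∀ k < a, k ∈ S.occ) (hb : ∀ k ∈ S.occ, k ≤ b) :
    (JMinus t)^[m] v S = (bilin (Finset.Icc a b) (shiftMatrix t) ^ m) v S := by
  induction m generalizing S with
  | zero => rfl
  | succ m ih =>
    rw [Function.iterate_succ_apply', pow_succ', Module.End.mul_apply]
    exact JMinus_eq_bilin t ih S ha hb

theorem neg_one_pow_smul_ketState_apply (c : R) (μ : YoungDiagram) (n : ℤ) (S : Maya) :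
    (((-1) ^ bNum μ * c) • (ketState μ n : Ket R)) S = c * ketOf (Maya.ofYoung μ n) S := by
  rw [ketState_eq, smul_smul, mul_right_comm, ← pow_add, Even.neg_one_pow ⟨_, rfl⟩, one_mul,
    Pi.smul_apply, smul_eq_mul]

theorem pairing_ketState (μ : YoungDiagram) (n : ℤ) (v : Ket R) :
    pairing (ketState μ n) v = (-1) ^ bNum μ * v (Maya.ofYoung μ n) := by
  rw [pairing, ketState_eq, finsum_eq_single _ (Maya.ofYoung μ n)]
  · simp [ketOf]
  · intro S hS
    simp [ketOf, hS]

theorem pairing_comm (U : Bra R) (v : Ket R) : pairing U v = pairing v U :=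
  finsum_congr fun _ => mul_comm _ _

end Truncation

theorem ofYoung_eq_ofTuple (μ : YoungDiagram) (n : ℤ) : Maya.ofYoung μ n =
    Maya.ofTuple (n - μ.colLen 0) fun i : Fin (μ.colLen 0) => n + μ.rowLen i - (i : ℕ) - 1 := by
  ext x
  rw [Maya.mem_ofTuple]
  constructor
  · rintro ⟨i, rfl⟩
    by_cases hi : i < μ.colLen 0
    · exact Or.inr ⟨⟨i, hi⟩, rfl⟩
    · have := rowLen_eq_zero (not_lt.mp hi)
      left
      simp only [this]
      omega
  · rintro (h | ⟨i, rfl⟩)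
    · refine ⟨(n - 1 - x).toNat, ?_⟩
      have := rowLen_eq_zero (μ := μ) (i := (n - 1 - x).toNat) (by omega)
      simp only [this]
      omega
    · exact ⟨i, rfl⟩

/-! ### The evolution equation and the coefficients of the coherent state -/

section CoherentState

variable {R : Type*} [CommRing R] [Algebra ℚ R]

/-- Cutting the sum to the window loses nothing: `h_{i-c}` vanishes for `i < c`, with `a ≤ c`, and
the shift matrix vanishes unless `i < j ≤ b`. -/
theorem derivative_hDeform_sub (t : ℕ → R) {a b c j : ℤ} (hac : a ≤ c) (hj : j ∈ Finset.Icc a b) :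
    derivative (hDeform t (j - c)) =
      ∑ i ∈ Finset.Icc a b, shiftMatrix (fun k => C (t k)) j i * hDeform t (i - c) := by
  rw [Finset.mem_Icc] at hj
  rcases lt_or_ge j c with h | h
  · rw [hDeform_of_neg t (by omega), derivative_zero, Finset.sum_eq_zero]
    intro i _
    by_cases hij : i < j
    · rw [hDeform_of_neg t (by omega), mul_zero]
    · rw [shiftMatrix, if_neg hij, zero_mul]
  · obtain ⟨k, hk⟩ := Int.eq_ofNat_of_zero_le (sub_nonneg.mpr h)
    rw [hk, derivative_hDeform]
    refine Finset.sum_bij_ne_zero (fun p _ _ => c + p.2) ?_ ?_ ?_ ?_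
    · intro p hp _
      rw [Finset.HasAntidiagonal.mem_antidiagonal] at hp
      rw [Finset.mem_Icc]
      omega
    · intro p hp _ q hq _ hpq
      rw [Finset.HasAntidiagonal.mem_antidiagonal] at hp hq
      ext <;> omega
    · intro i _ hne
      have hij : i < j := by
        by_contra h'
        simp [shiftMatrix, h'] at hne
      have hic : c ≤ i := by
        by_contra h'
        rw [hDeform_of_neg t (by omega), mul_zero] at hne
        exact hne rfl
      refine ⟨((j - i).toNat, (i - c).toNat), by rw [Finset.HasAntidiagonal.mem_antidiagonal]; omega, ?_,
        by simp only; omega⟩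
      rw [shiftMatrix, if_pos hij] at hne
      simp only
      rw [if_neg (by omega), Int.toNat_of_nonneg (by omega)]
      exact hne
    · intro p hp hne
      rw [Finset.HasAntidiagonal.mem_antidiagonal] at hp
      have h0 : p.1 ≠ 0 := fun h0 => hne (if_pos h0)
      rw [if_neg h0, shiftMatrix, if_pos (by omega), add_sub_cancel_left,
        show (j - (c + p.2)).toNat = p.1 by omega]

/-- Differentiation and the quadratic operator obey the same Leibniz rule along the wedge, agree on
each factor, and both kill the vacuum of charge `a`. -/
theorem derivative_wedge (t : ℕ → R) (a b : ℤ) (N : ℕ) :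
    (fun S => derivative (wedge (Finset.Icc a b) a (hDeform t) N S)) =
      bilin (Finset.Icc a b) (shiftMatrix fun k => C (t k))
        (wedge (Finset.Icc a b) a (hDeform t) N) := by
  induction N with
  | zero =>
    rw [wedge, bilin_shiftMatrix_vac]
    funext S
    by_cases h : S = Maya.vac a <;> simp [ketOf, h]
  | succ N ih =>
    rw [wedge, derivative_field, ih, ← Module.End.mul_apply, ← Module.End.mul_apply,
      bilin_mul_field, LinearMap.add_apply]
    congr 1
    funext S
    rw [field_apply, field_apply]
    refine Finset.sum_congr rfl fun j hj => ?_
    rw [derivative_hDeform_sub t (by omega) hj]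

/-- At `X = 0` each factor reduces to the single `ψ_{a+N}` at the Fermi level; the bound on `b`
keeps this mode inside the window. -/
theorem coeff_zero_wedge (t : ℕ → R) (a b : ℤ) {N : ℕ} (hb : a + N ≤ b + 1) :
    (fun S => (wedge (Finset.Icc a b) a (hDeform t) N S).coeff 0) = ketOf (Maya.vac (a + N)) := by
  induction N with
  | zero =>
    funext S
    by_cases h : S = Maya.vac a <;> simp [wedge, ketOf, h]
  | succ N ih =>
    funext S
    push_cast at hb
    rw [wedge, coeff_zero_field, ih (by omega), field_apply,
      Finset.sum_eq_single_of_mem (a + (N : ℤ)) (Finset.mem_Icc.mpr (by omega)), psiKet_vac,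
      coeff_zero_hDeform, sub_self, if_pos rfl, one_mul, Nat.cast_succ, add_assoc]
    intro m _ hm
    rw [coeff_zero_hDeform, if_neg (sub_ne_zero.mpr hm), zero_mul]

theorem coeff_wedge (t : ℕ → R) (a b : ℤ) {N : ℕ} (hb : a + N ≤ b + 1) (m : ℕ) :
    (fun S => (wedge (Finset.Icc a b) a (hDeform t) N S).coeff m) =
      (m.factorial : ℚ)⁻¹ •
        (bilin (Finset.Icc a b) (shiftMatrix t) ^ m) (ketOf (Maya.vac (a + N))) := by
  induction m with
  | zero => simp [coeff_zero_wedge t a b hb]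
  | succ m ih =>
    funext S
    have h1 := congrArg (fun p : R[X] => p.coeff m) (congrFun (derivative_wedge t a b N) S)
    simp only [coeff_derivative, coeff_bilin, ih] at h1
    rw [LinearMap.map_smul_of_tower, ← Module.End.mul_apply, ← pow_succ'] at h1
    -- The recursion only determines `m + 1` times the next coefficient; over a `ℚ`-algebra this
    -- factor can be cancelled.
    have h2 : IsUnit ((m : R) + 1) := by
      have := (IsUnit.mk0 ((m : ℚ) + 1) (by positivity)).map (algebraMap ℚ R)
      simpa using this
    refine h2.mul_left_cancel ?_
    rw [mul_comm, h1, Pi.smul_apply, Pi.smul_apply, smul_factorial_succ]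

theorem expJMinus_vac (t : ℕ → R) {a b : ℤ} {N : ℕ} (hN : a + N ≤ b + 1) {S : Maya}
    (ha : ∀ k < a, k ∈ S.occ) (hb : ∀ k ∈ S.occ, k ≤ b) :
    expJMinus t (ketOf (Maya.vac (a + N))) S =
      (wedge (Finset.Icc a b) a (hDeform t) N S).eval 1 := by
  rw [expJMinus, eval_eq_sum, Polynomial.sum, finsum_eq_finsetSum_of_support_subset
    (s := (wedge (Finset.Icc a b) a (hDeform t) N S).support)]
  · refine Finset.sum_congr rfl fun m _ => ?_
    rw [one_pow, mul_one, JMinus_iterate_eq_bilin t _ m S ha hb, ← Pi.smul_apply,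
      ← coeff_wedge t a b hN m]
  · intro m hm
    rw [Finset.mem_coe, mem_support_iff, congrFun (coeff_wedge t a b hN m) S, Pi.smul_apply,
      ← JMinus_iterate_eq_bilin t _ m S ha hb]
    exact hm

theorem expJMinus_vac_ofYoung (t : ℕ → R) (μ : YoungDiagram) (n : ℤ) :
    expJMinus t (ketVac n) (Maya.ofYoung μ n) = schur μ t := by
  have hs : StrictAnti fun i : Fin (μ.colLen 0) => n + μ.rowLen i - (i : ℕ) - 1 :=
    fun i j hij => rowLen_sub_strictAnti μ n hij
  have ha : ∀ i : Fin (μ.colLen 0), n - μ.colLen 0 ≤ n + μ.rowLen i - (i : ℕ) - 1 := fun i => by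
    omega
  have hb : ∀ i : Fin (μ.colLen 0), n + μ.rowLen i - (i : ℕ) - 1 ≤ n + μ.rowLen 0 := fun i => by
    have := μ.rowLen_anti 0 i (Nat.zero_le _)
    omega
  -- With `a = n - ℓ(μ)` and `N = ℓ(μ)` the wedge determinant has the size of the Jacobi–Trudi
  -- matrix, and the argument `s_i - (a + N - 1 - j)` becomes `μ_i - i + j`.
  have hn : n = n - μ.colLen 0 + μ.colLen 0 := by ring
  rw [ketVac_eq, ofYoung_eq_ofTuple, congrArg Maya.vac hn, expJMinus_vac (b := n + μ.rowLen 0) t (by omega)]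
  · rw [wedge_ofTuple hs ha hb, ← coe_evalRingHom, RingHom.map_det, schur]
    congr 1
    ext i j
    simp only [RingHom.mapMatrix_apply, Matrix.map_apply, Matrix.of_apply, coe_evalRingHom,
      eval_one_hDeform]
    congr 1
    ring
  · exact fun k hk => Maya.mem_ofTuple.mpr (Or.inl hk)
  · intro k hk
    rcases Maya.mem_ofTuple.mp hk with h | ⟨i, rfl⟩
    · omega
    · exact hb i

theorem exists_ofYoung_of_expJMinus_ne_zero (t : ℕ → R) (n : ℤ) {S : Maya}
    (h : expJMinus t (ketVac n) S ≠ 0) : ∃ μ : YoungDiagram, S = Maya.ofYoung μ n := by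
  obtain ⟨a, b, ha, hb⟩ := S.exists_bounds
  -- The window is enlarged to contain the Fermi level `n`, so that `|n⟩` is a wedge over its lower
  -- edge.
  obtain ⟨N, hN⟩ := Int.eq_ofNat_of_zero_le (sub_nonneg.mpr (min_le_right a n))
  have hn : n = min a n + N := by omega
  rw [ketVac_eq, hn, expJMinus_vac (a := min a n) (b := max b n) t (by omega)
    (fun k hk => ha k (by omega)) fun k hk => by have := hb k hk; omega] at h
  rw [hn]
  exact exists_ofYoung_of_wedge_ne_zero (g := hDeform t) fun h' => h (by rw [h', eval_zero])

theorem isFormalSum_expJMinus (t : ℕ → R) (n : ℤ) :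
    IsFormalSum (fun μ : YoungDiagram => ((-1) ^ bNum μ * schur μ t) • (ketState μ n : Ket R))
      (expJMinus t (ketVac n)) := by
  intro S
  simp only [neg_one_pow_smul_ketState_apply]
  by_cases h : ∃ μ : YoungDiagram, S = Maya.ofYoung μ n
  · obtain ⟨μ, rfl⟩ := h
    have h0 : ∀ ν, ν ≠ μ → schur ν t * ketOf (Maya.ofYoung ν n) (Maya.ofYoung μ n) = 0 :=
      fun ν hν => by
        rw [ketOf, if_neg fun h => hν (Maya.ofYoung_injective n h).symm, mul_zero]
    refine ⟨(Set.finite_singleton μ).subset fun ν hν => ?_, ?_⟩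
    · by_contra h
      exact hν (h0 ν h)
    · rw [finsum_eq_single _ μ h0, ketOf, if_pos rfl, mul_one, expJMinus_vac_ofYoung]
  · have h0 : ∀ ν, schur ν t * ketOf (Maya.ofYoung ν n) S = 0 := fun ν => by
      rw [ketOf, if_neg fun h' => h ⟨ν, h'⟩, mul_zero]
    have h1 : expJMinus t (ketVac n) S = 0 := by
      by_contra h'
      exact h (exists_ofYoung_of_expJMinus_ne_zero t n h')
    simp [h0, h1]

end CoherentState

end FermiFock

theorem mainTheorem3 {R : Type*} [CommRing R] [Algebra ℚ R] (t : ℕ → R) (n : ℤ) :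
    FermiFock.IsFormalSum
      (fun μ : YoungDiagram =>
        ((-1) ^ FermiFock.bNum μ * FermiFock.schur μ t) • (FermiFock.ketState μ n : FermiFock.Ket R))
      (FermiFock.expJMinus t (FermiFock.ketVac n)) ∧
    FermiFock.IsFormalSum
      (fun μ : YoungDiagram =>
        ((-1) ^ FermiFock.bNum μ * FermiFock.schur μ t) • (FermiFock.braState μ n : FermiFock.Bra R))
      (FermiFock.expJPlus t (FermiFock.braVac n)) ∧
    (∀ μ : YoungDiagram,
      FermiFock.pairing (FermiFock.braState μ n) (FermiFock.expJMinus t (FermiFock.ketVac n)) =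
        (-1) ^ FermiFock.bNum μ * FermiFock.schur μ t) ∧
    (∀ μ : YoungDiagram,
      FermiFock.pairing (FermiFock.expJPlus t (FermiFock.braVac n)) (FermiFock.ketState μ n) =
        (-1) ^ FermiFock.bNum μ * FermiFock.schur μ t) := by
  open FermiFock in
  have h1 := isFormalSum_expJMinus t n
  have h2 : ∀ μ : YoungDiagram, pairing (ketState μ n) (expJMinus t (ketVac n)) =
      (-1) ^ bNum μ * schur μ t := fun μ => by
    rw [pairing_ketState, expJMinus_vac_ofYoung]
  -- After transposition and the symmetry of the pairing, the bra statements coincide with the ket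
  -- statements.
  simp only [braState_eq, braVac_eq, expJPlus_eq, pairing_comm (expJMinus t _)]
  exact ⟨h1, h1, h2, h2⟩
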